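/- A permutation of length $n\ge 0$ is a bijection of $\{1,\dots,n\}$, written as the sequence $\pi(1)\cdots\pi(n)$. It contains a permutation $\sigma$ if it has a subsequence that is order isomorphic to $\sigma$. A permutation class is a (possibly empty) set $\mathcal{C}$ of permutations such that every permutation contained in a member of $\mathcal{C}$ is itself in $\mathcal{C}$. Let $\mathcal{C}_n$ be the set of members of length $n$. The class $\mathcal{C}$ has the proper growth rate $\mathrm{gr}(\mathcal{C})$ if $\lim_{n\to\infty}\sqrt[n]{|\mathcal{C}_n|}$ exists as a (finite) real number, and then $\mathrm{gr}(\mathcal{C})$ denotes this limit. Let $t,u\ge 1$ and let $\mathcal{M}=(\mathcal{M}_{k,\ell})$, $1\le k\le t$, $1\le \ell\le u$, be a $t\times u$ matrix of permutation classes. An $\mathcal{M}$-gridding of a permutation $\pi$ of length $n$ is a pair of integer sequences $1=c_1\le\cdots\le c_{t+1}=n+1$ and $1=r_1\le\cdots\le r_{u+1}=n+1$ such that, for all $k$ and $\ell$, the entries of $\pi$ with indices in $[c_k,c_{k+1})$ and values in $[r_\ell,r_{\ell+1})$, if there are any, are order isomorphic to a permutation in $\mathcal{M}_{k,\ell}$.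 Let $\operatorname{Grid}(\mathcal{M})$ be the set of all permutations that have an $\mathcal{M}$-gridding. **Theorem.** Suppose that each $\mathcal{M}_{k,\ell}$ has a proper growth rate, and let $\Gamma$ be the real $t\times u$ matrix with $\Gamma_{k,\ell}=\sqrt{\mathrm{gr}(\mathcal{M}_{k,\ell})}$. Then $\operatorname{Grid}(\mathcal{M})$ has a proper growth rate, and it is equal to the greatest eigenvalue of $\Gamma^T\Gamma$ and also to the greatest eigenvalue of $\Gamma\Gamma^T$. -/

import Mathlib

namespace GridClass

/-- A set of finite permutations, given length by length: `C n` is the set of its members of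
length `n`. Positions and values of a permutation of length `n` are numbered `0, …, n - 1`. -/
abbrev PermSet : Type := ∀ n : ℕ, Set (Equiv.Perm (Fin n))

/-- The subsequence of `π` at the positions `f 0 < f 1 < ⋯ < f (k - 1)` is order isomorphic
to `σ`. -/
def OrderIsoAt {n k : ℕ} (π : Equiv.Perm (Fin n)) (f : Fin k ↪o Fin n)
    (σ : Equiv.Perm (Fin k)) : Prop :=
  ∀ i j : Fin k, π (f i) < π (f j) ↔ σ i < σ j

/-- `π` contains `σ`: some subsequence of `π` is order isomorphic to `σ`. -/
def Contains {n k : ℕ} (π : Equiv.Perm (Fin n)) (σ : Equiv.Perm (Fin k)) : Prop :=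
  ∃ f : Fin k ↪o Fin n, OrderIsoAt π f σ

/-- A permutation class: a set of permutations that is closed downward under containment. -/
def IsPermClass (C : PermSet) : Prop :=
  ∀ (n k : ℕ) (π : Equiv.Perm (Fin n)) (σ : Equiv.Perm (Fin k)),
    π ∈ C n → Contains π σ → σ ∈ C k

/-- `C` has the proper growth rate `g`: the sequence of the `n`-th roots of the numbers of
members of length `n` converges to the real number `g`. -/
def HasProperGrowthRate (C : PermSet) (g : ℝ) : Prop :=
  Filter.Tendsto (fun n : ℕ => ((C n).ncard : ℝ) ^ (1 / (n : ℝ))) Filter.atTop (nhds g)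

/-- A weakly increasing sequence `0 = d 0 ≤ d 1 ≤ ⋯ ≤ d s = n`, which divides `{0, …, n - 1}`
into the `s` (possibly empty) intervals `[d k, d (k + 1))`. -/
def IsDivision (s n : ℕ) (d : Fin (s + 1) → ℕ) : Prop :=
  Monotone d ∧ d 0 = 0 ∧ d (Fin.last s) = n

/-- The positions of the entries of `π` in the cell `(k, ℓ)` (column `k` from the left, row `ℓ`
from the bottom) that the column divisions `c` and the row divisions `r` cut out. -/
def cell {t u n : ℕ} (π : Equiv.Perm (Fin n)) (c : Fin (t + 1) → ℕ) (r : Fin (u + 1) → ℕ)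
    (k : Fin t) (l : Fin u) : Set (Fin n) :=
  {i | (i : ℕ) ∈ Set.Ico (c k.castSucc) (c k.succ) ∧
    (π i : ℕ) ∈ Set.Ico (r l.castSucc) (r l.succ)}

/-- The divisions `c`, `r` form an `M`-gridding of `π`: the entries in each cell `(k, ℓ)`, if
there are any, are order isomorphic to a member of `M k ℓ`. A cell without entries is always
allowed, so that the empty class may be used for the cells that have to stay empty. -/
def IsGridding {t u n : ℕ} (M : Matrix (Fin t) (Fin u) PermSet) (π : Equiv.Perm (Fin n))
    (c : Fin (t + 1) → ℕ) (r : Fin (u + 1) → ℕ) : Prop :=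
  IsDivision t n c ∧ IsDivision u n r ∧
    ∀ (k : Fin t) (l : Fin u), (cell π c r k l).Nonempty →
      ∃ (m : ℕ) (σ : Equiv.Perm (Fin m)) (f : Fin m ↪o Fin n),
        σ ∈ M k l m ∧ Set.range f = cell π c r k l ∧ OrderIsoAt π f σ

/-- The grid class of `M`: all permutations that have an `M`-gridding. -/
def Grid {t u : ℕ} (M : Matrix (Fin t) (Fin u) PermSet) : PermSet :=
  fun _ => {π | ∃ c r, IsGridding M π c r}

end GridClass

/-! Fix the divisions and the number `a k l` of entries in each cell. A gridded permutation is then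
the same as three independent choices: for each column, the order in which its entries visit the
rows; for each row, read by value, the order in which its entries visit the columns; and a class
member in each cell. The number of choices is a product of multinomial coefficients and cell counts
(`ncard_griddedPerms`). Only polynomially many triples of divisions and cell counts exist, so the
growth rate is the exponential rate of the largest such product.

Upper bound: for `τ > ρ` there are `Γ' > Γ` entrywise and positive `v`, `w` with `Γ' v ≤ √τ w` and
`Γ'ᵀ w ≤ √τ v`. Weighting words by `Γ' k l * v l`, respectively `Γ' k l * w k`, bounds the two
multinomial products; when the bounds are multiplied, the monomials in `v` and `w` cancel and leave
`τ ^ n` (`ncard_griddedPerms_le`).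

Lower bound: let `v` be a nonnegative unit eigenvector of `Γᵀ Γ` for its greatest eigenvalue `ρ`,
and `w = Γ v / √ρ`. Filling the cells in the proportions `w k * Γ k l * v l / √ρ` makes the two
bounds asymptotically sharp: Stirling's formula gives the rate exactly `ρ`
(`eventually_lt_rpow_grid`). -/

namespace GridClass

open Finset

/-! ### Counting words with prescribed letter frequencies -/

/-- The words `W` over the alphabet `ι` in which, among the positions `i` with `col i = k`, the
letter `l` occurs `a k l` times. -/
def refinements {α κ ι : Type*} [Fintype α] [DecidableEq α] [Fintype κ] [DecidableEq κ]
    [Fintype ι] [DecidableEq ι] (col : α → κ) (a : κ → ι → ℕ) : Finset (α → ι) :=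
  univ.filter fun W => ∀ k l, #{i | col i = k ∧ W i = l} = a k l

section Refinements

variable {α κ ι : Type*} [Fintype α] [DecidableEq α] [Fintype κ] [DecidableEq κ]
  [Fintype ι] [DecidableEq ι] {col : α → κ} {a : κ → ι → ℕ}

theorem mem_refinements {W : α → ι} :
    W ∈ refinements col a ↔ ∀ k l, #{i | col i = k ∧ W i = l} = a k l := by
  simp [refinements]

theorem prod_of_mem_refinements {W : α → ι} (hW : W ∈ refinements col a) (y : κ → ι → ℝ) :
    ∏ i, y (col i) (W i) = ∏ k, ∏ l, y k l ^ a k l := by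
  rw [← Fintype.prod_prod_type' (fun k l => y k l ^ a k l),
    ← Finset.prod_fiberwise univ (fun i => (col i, W i))]
  refine Finset.prod_congr rfl fun c _ => ?_
  rw [Finset.prod_congr rfl (g := fun _ => y c.1 c.2), Finset.prod_const]
  · congr 1
    rw [← mem_refinements.1 hW c.1 c.2]
    congr 1
    ext i
    simp [Prod.ext_iff]
  · intro i hi
    simp only [Finset.mem_filter, Finset.mem_univ, true_and] at hi
    simp [← hi]

/-- Expanding the product on the right gives a sum over all words, in which each word of
`refinements col a` contributes the same monomial. -/
theorem card_refinements_mul_le (y : κ → ι → ℝ) (hy : ∀ k l, 0 ≤ y k l) :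
    (#(refinements col a) : ℝ) * ∏ k, ∏ l, y k l ^ a k l ≤ ∏ i, ∑ l, y (col i) l := by
  calc (#(refinements col a) : ℝ) * ∏ k, ∏ l, y k l ^ a k l
      = ∑ W ∈ refinements col a, ∏ i, y (col i) (W i) := by
        rw [Finset.sum_congr rfl fun W hW => prod_of_mem_refinements hW y]
        simp
    _ ≤ ∑ W : α → ι, ∏ i, y (col i) (W i) :=
        Finset.sum_le_sum_of_subset_of_nonneg (Finset.subset_univ _)
          fun W _ _ => Finset.prod_nonneg fun i _ => hy _ _
    _ = ∏ i, ∑ l, y (col i) l := by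
        rw [Finset.prod_univ_sum, Fintype.piFinset_univ]

theorem refinements_nonempty (h : ∀ k, #{i | col i = k} = ∑ l, a k l) :
    (refinements col a).Nonempty := by
  have e : ∀ k, {i // col i = k} ≃ Σ l, Fin (a k l) := fun k =>
    Fintype.equivOfCardEq (by rw [Fintype.card_subtype, h]; simp)
  refine ⟨fun i => (e (col i) ⟨i, rfl⟩).1, mem_refinements.2 fun k l => ?_⟩
  have hinj : Function.Injective fun x : Fin (a k l) => ((e k).symm ⟨l, x⟩).1 := by
    intro x y hxy
    simpa using (e k).symm.injective (Subtype.ext hxy)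
  rw [← Fintype.card_fin (a k l), ← Finset.card_univ, ← Finset.card_image_of_injective _ hinj]
  congr 1
  ext i
  simp only [Finset.mem_filter, Finset.mem_univ, true_and, Finset.mem_image]
  constructor
  · rintro ⟨rfl, rfl⟩
    exact ⟨(e (col i) ⟨i, rfl⟩).2, by simp⟩
  · rintro ⟨x, rfl⟩
    have key : ∀ z : {i // col i = k}, e (col z.1) ⟨z.1, rfl⟩ =
        (⟨(e k z).1, z.2.symm ▸ (e k z).2⟩ : Σ l, Fin (a (col z.1) l)) := by
      rintro ⟨z, rfl⟩
      rfl
    exact ⟨((e k).symm ⟨l, x⟩).2, by rw [key]; simp⟩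

/-- The lower multinomial bound by double counting: the permutations preserving `col` act on a fixed
word `W`, and those yielding a given word are at most as many as the permutations preserving both
`col` and `W`. -/
theorem prod_factorial_le (h : ∀ k, #{i | col i = k} = ∑ l, a k l) :
    ∏ k, (∑ l, a k l).factorial ≤ #(refinements col a) * ∏ k, ∏ l, (a k l).factorial := by
  obtain ⟨W, hW⟩ := refinements_nonempty h
  have hW' := mem_refinements.1 hW
  have h1 := DomMulAct.stabilizer_card col
  simp only [Fintype.card_subtype, h] at h1
  have h2 := DomMulAct.stabilizer_card fun i => (col i, W i)
  simp only [Fintype.card_subtype, Fintype.prod_prod_type, Prod.mk.injEq, hW'] at h2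
  rw [← h1, ← h2, mul_comm]
  refine Finset.card_le_mul_card_image_of_maps_to (f := fun π : Equiv.Perm α => W ∘ π) ?_ _ ?_
  · intro π hπ
    simp only [Finset.mem_filter, Finset.mem_univ, true_and] at hπ
    refine mem_refinements.2 fun k l => ?_
    rw [← hW' k l]
    refine Finset.card_equiv π fun i => ?_
    have := congrFun hπ i
    simp only [Function.comp_apply] at this
    simp [this]
  · intro V _
    by_cases hV : ∃ π₀ : Equiv.Perm α, col ∘ π₀ = col ∧ W ∘ π₀ = V
    · obtain ⟨π₀, hc, rfl⟩ := hV
      -- Dividing by one solution `π₀` moves the solution set into the joint stabilizer.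
      refine Finset.card_le_card_of_injOn (fun π => π * π₀⁻¹) ?_
        (mul_left_injective π₀⁻¹).injOn
      intro π hπ
      simp only [Finset.coe_filter, Finset.mem_filter, Finset.mem_univ, true_and,
        Set.mem_ofPred_eq] at hπ ⊢
      funext i
      have e1 := congrFun hπ.1 (π₀.symm i)
      have e2 := congrFun hπ.2 (π₀.symm i)
      have e3 := congrFun hc (π₀.symm i)
      simp only [Function.comp_apply, Equiv.apply_symm_apply] at e1 e2 e3
      simp [e1, e2, e3]
    · rw [Finset.card_eq_zero.2]
      · exact Nat.zero_le _
      · refine Finset.filter_eq_empty_iff.2 fun π hπ hV' => hV ⟨π, ?_, hV'⟩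
        simpa using hπ

end Refinements

/-! ### Permutations built fiber by fiber -/

section Fibers

variable {n : ℕ} {K : Type*} [DecidableEq K] {a : K → ℕ}

/-- The increasing enumeration of a fiber of size `a c`. -/
def fiberEmb (f : Fin n → K) (hf : ∀ c, #{i | f i = c} = a c) (c : K) : Fin (a c) ↪o Fin n :=
  ({i | f i = c} : Finset (Fin n)).orderEmbOfFin (hf c)

theorem range_fiberEmb (f : Fin n → K) (hf : ∀ c, #{i | f i = c} = a c) (c : K) :
    Set.range (fiberEmb f hf c) = {i | f i = c} := by
  simp [fiberEmb]

theorem apply_fiberEmb (f : Fin n → K) (hf : ∀ c, #{i | f i = c} = a c) (c : K)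
    (x : Fin (a c)) : f (fiberEmb f hf c x) = c := by
  have : fiberEmb f hf c x ∈ {i | f i = c} := range_fiberEmb f hf c ▸ Set.mem_range_self x
  exact this

theorem exists_fiberEmb_eq (f : Fin n → K) (hf : ∀ c, #{i | f i = c} = a c) (i : Fin n) :
    ∃ x, fiberEmb f hf (f i) x = i := by
  have : i ∈ Set.range (fiberEmb f hf (f i)) := by simp [range_fiberEmb]
  exact this

theorem eq_fiberEmb (f : Fin n → K) (hf : ∀ c, #{i | f i = c} = a c) (c : K)
    {e : Fin (a c) → Fin n} (he : ∀ x, f (e x) = c) (hm : StrictMono e) :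
    e = fiberEmb f hf c :=
  Finset.orderEmbOfFin_unique (hf c) (by simpa using he) hm

/-- The enumeration of `Fin n` by the increasing enumerations of the fibers. -/
noncomputable def fiberEquiv (f : Fin n → K) (hf : ∀ c, #{i | f i = c} = a c) :
    (Σ c, Fin (a c)) ≃ Fin n :=
  Equiv.ofBijective (fun p => fiberEmb f hf p.1 p.2) <| by
    constructor
    · rintro ⟨c, x⟩ ⟨d, y⟩ h
      obtain rfl : c = d := by
        rw [← apply_fiberEmb f hf c x, ← apply_fiberEmb f hf d y]
        exact congrArg f h
      simpa using h
    · intro i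
      obtain ⟨x, hx⟩ := exists_fiberEmb_eq f hf i
      exact ⟨⟨f i, x⟩, hx⟩

/-- The permutation that maps the fibers of `f` to those of `g` and acts on the fiber of `c` in
the same way as `σ c`. -/
noncomputable def fiberPerm (f g : Fin n → K) (hf : ∀ c, #{i | f i = c} = a c)
    (hg : ∀ c, #{i | g i = c} = a c) (σ : ∀ c, Equiv.Perm (Fin (a c))) : Equiv.Perm (Fin n) :=
  (fiberEquiv f hf).symm.trans ((Equiv.sigmaCongrRight σ).trans (fiberEquiv g hg))

theorem fiberPerm_fiberEmb (f g : Fin n → K) (hf : ∀ c, #{i | f i = c} = a c)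
    (hg : ∀ c, #{i | g i = c} = a c) (σ : ∀ c, Equiv.Perm (Fin (a c))) (c : K) (x : Fin (a c)) :
    fiberPerm f g hf hg σ (fiberEmb f hf c x) = fiberEmb g hg c (σ c x) := by
  have : fiberEmb f hf c x = fiberEquiv f hf ⟨c, x⟩ := rfl
  rw [fiberPerm, this, Equiv.trans_apply, Equiv.symm_apply_apply]
  rfl

theorem apply_fiberPerm (f g : Fin n → K) (hf : ∀ c, #{i | f i = c} = a c)
    (hg : ∀ c, #{i | g i = c} = a c) (σ : ∀ c, Equiv.Perm (Fin (a c))) (i : Fin n) :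
    g (fiberPerm f g hf hg σ i) = f i := by
  obtain ⟨x, hx⟩ := exists_fiberEmb_eq f hf i
  conv_lhs => rw [← hx]
  rw [fiberPerm_fiberEmb]
  exact apply_fiberEmb g hg _ _

theorem orderIsoAt_fiberPerm (f g : Fin n → K) (hf : ∀ c, #{i | f i = c} = a c)
    (hg : ∀ c, #{i | g i = c} = a c) (σ : ∀ c, Equiv.Perm (Fin (a c))) (c : K) :
    OrderIsoAt (fiberPerm f g hf hg σ) (fiberEmb f hf c) (σ c) := by
  intro i j
  rw [fiberPerm_fiberEmb, fiberPerm_fiberEmb, OrderEmbedding.lt_iff_lt]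

/-- On the fiber of `c`, undoing `σ c` before applying `π` leaves an increasing map into the fiber
of `g`, which can only be the increasing enumeration. -/
theorem eq_fiberPerm {f g : Fin n → K} (hf : ∀ c, #{i | f i = c} = a c)
    (hg : ∀ c, #{i | g i = c} = a c) {σ : ∀ c, Equiv.Perm (Fin (a c))} {π : Equiv.Perm (Fin n)}
    (hπ : ∀ i, g (π i) = f i) (hσ : ∀ c, OrderIsoAt π (fiberEmb f hf c) (σ c)) :
    π = fiberPerm f g hf hg σ := by
  ext1 i
  obtain ⟨x, hx⟩ := exists_fiberEmb_eq f hf i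
  rw [← hx, fiberPerm_fiberEmb]
  have := eq_fiberEmb g hg (f i) (e := fun y => π (fiberEmb f hf (f i) ((σ (f i)).symm y)))
    (fun y => (hπ _).trans (apply_fiberEmb f hf _ _))
    (fun y z hyz => (hσ _ _ _).2 (by simpa using hyz))
  simpa using congrFun this (σ (f i) x)

end Fibers

/-! ### Gridded permutations and their exact number -/

/-- The permutations of length `m` that may fill a cell for the class `C`. -/
def cellMembers (C : PermSet) (m : ℕ) : Set (Equiv.Perm (Fin m)) := {σ | m = 0 ∨ σ ∈ C m}

variable {t u n : ℕ}

/-- The permutations that are gridded by the columns `col` of positions and the rows `row` of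
values, with `a k l` entries in the cell `(k, l)`. -/
def griddedPerms (M : Matrix (Fin t) (Fin u) PermSet) (col : Fin n → Fin t) (row : Fin n → Fin u)
    (a : Fin t → Fin u → ℕ) : Set (Equiv.Perm (Fin n)) :=
  {π | ∀ k l, ∃ σ ∈ cellMembers (M k l) (a k l), ∃ e : Fin (a k l) ↪o Fin n,
    Set.range e = {i | col i = k ∧ row (π i) = l} ∧ OrderIsoAt π e σ}

/-- The two patterns differ by an increasing permutation of `Fin m`, which is the identity. -/
theorem orderIsoAt_unique {n m : ℕ} {π : Equiv.Perm (Fin n)} {e : Fin m ↪o Fin n}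
    {σ τ : Equiv.Perm (Fin m)} (hσ : OrderIsoAt π e σ) (hτ : OrderIsoAt π e τ) : σ = τ := by
  have hm : StrictMono (σ.symm.trans τ) := by
    intro x y hxy
    refine (hτ _ _).1 ((hσ _ _).2 ?_)
    simpa using hxy
  have hid : (σ.symm.trans τ : Fin m → Fin m) = id :=
    (Finset.orderEmbOfFin_unique (s := univ) (by simp) (by simp) hm).trans
      (Finset.orderEmbOfFin_unique (s := univ) (by simp) (by simp) strictMono_id).symm
  ext1 x
  simpa using (congrFun hid (σ x)).symm

theorem card_fiber_of_mem_refinements {col : Fin n → Fin t} {a : Fin t → Fin u → ℕ}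
    {W : Fin n → Fin u} (hW : W ∈ refinements col a) (c : Fin t × Fin u) :
    #{i | (col i, W i) = c} = a c.1 c.2 := by
  rw [← mem_refinements.1 hW c.1 c.2]
  simp [Prod.ext_iff]

theorem card_fiber_of_mem_refinements' {row : Fin n → Fin u} {a : Fin t → Fin u → ℕ}
    {V : Fin n → Fin t} (hV : V ∈ refinements row fun l k => a k l) (c : Fin t × Fin u) :
    #{i | (V i, row i) = c} = a c.1 c.2 := by
  rw [← mem_refinements.1 hV c.2 c.1]
  simp [Prod.ext_iff, and_comm]

section Assemble

variable {M : Matrix (Fin t) (Fin u) PermSet} {col : Fin n → Fin t} {row : Fin n → Fin u}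
  {a : Fin t → Fin u → ℕ}

/-- The gridded permutation with given sequences of rows of the entries by position and of columns
of the entries by value, and with given permutations in the cells. -/
noncomputable def assemble (d : refinements col a × refinements row (fun l k => a k l) ×
    (∀ c : Fin t × Fin u, cellMembers (M c.1 c.2) (a c.1 c.2))) : Equiv.Perm (Fin n) :=
  fiberPerm (fun i => (col i, d.1.1 i)) (fun j => (d.2.1.1 j, row j))
    (card_fiber_of_mem_refinements d.1.2) (card_fiber_of_mem_refinements' d.2.1.2)
    fun c => (d.2.2 c).1

theorem assemble_label (d : refinements col a × refinements row (fun l k => a k l) ×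
    (∀ c : Fin t × Fin u, cellMembers (M c.1 c.2) (a c.1 c.2))) (i : Fin n) :
    d.2.1.1 (assemble d i) = col i ∧ row (assemble d i) = d.1.1 i :=
  Prod.ext_iff.1 <| apply_fiberPerm (fun i => (col i, d.1.1 i)) (fun j => (d.2.1.1 j, row j))
    (card_fiber_of_mem_refinements d.1.2) (card_fiber_of_mem_refinements' d.2.1.2) _ i

theorem orderIsoAt_assemble (d : refinements col a × refinements row (fun l k => a k l) ×
    (∀ c : Fin t × Fin u, cellMembers (M c.1 c.2) (a c.1 c.2))) (c : Fin t × Fin u) :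
    OrderIsoAt (assemble d)
      (fiberEmb (fun i => (col i, d.1.1 i)) (card_fiber_of_mem_refinements d.1.2) c)
      (d.2.2 c).1 :=
  orderIsoAt_fiberPerm _ _ _ _ (fun c => (d.2.2 c).1) c

/-- All data can be read off the permutation: the words from the row and column labels of its
entries, the cell contents from uniqueness of patterns. -/
theorem assemble_injective : Function.Injective
    (assemble (M := M) (col := col) (row := row) (a := a)) := by
  rintro ⟨W, V, σ⟩ ⟨W', V', σ'⟩ h
  obtain rfl : W = W' := by
    ext1; funext i
    have h1 := (assemble_label (M := M) ⟨W, V, σ⟩ i).2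
    rw [h] at h1
    exact h1.symm.trans (assemble_label ⟨W', V', σ'⟩ i).2
  obtain rfl : V = V' := by
    ext1; funext j
    have h1 := (assemble_label (M := M) ⟨W, V, σ⟩ ((assemble ⟨W, V, σ⟩).symm j)).1
    have h2 := (assemble_label (M := M) ⟨W, V', σ'⟩ ((assemble ⟨W, V, σ⟩).symm j)).1
    rw [← h] at h2
    simp only [Equiv.apply_symm_apply] at h1 h2
    exact h1.trans h2.symm
  congr 2
  funext c
  ext1
  have := orderIsoAt_assemble (M := M) ⟨W, V, σ'⟩ c
  rw [← h] at this
  exact orderIsoAt_unique (orderIsoAt_assemble (M := M) ⟨W, V, σ⟩ c) this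

theorem assemble_mem_griddedPerms (d : refinements col a × refinements row (fun l k => a k l) ×
    (∀ c : Fin t × Fin u, cellMembers (M c.1 c.2) (a c.1 c.2))) :
    assemble d ∈ griddedPerms M col row a := by
  intro k l
  refine ⟨(d.2.2 (k, l)).1, (d.2.2 (k, l)).2, _, ?_, orderIsoAt_assemble d (k, l)⟩
  rw [range_fiberEmb]
  ext i
  simp only [Set.mem_ofPred_eq, Prod.mk.injEq, (assemble_label d i).2]

theorem exists_assemble_eq {π : Equiv.Perm (Fin n)} (hπ : π ∈ griddedPerms M col row a) :
    ∃ d, assemble (M := M) (col := col) (row := row) (a := a) d = π := by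
  choose σ hσ e he hiso using hπ
  have hcard : ∀ k l, #{i | col i = k ∧ row (π i) = l} = a k l := by
    intro k l
    rw [← Set.ncard_coe_finset, Finset.coe_filter]
    simp only [Finset.mem_univ, true_and]
    rw [← he k l, ← Set.image_univ, Set.ncard_image_of_injective _ (e k l).injective]
    simp
  have hW : (fun i => row (π i)) ∈ refinements col a := mem_refinements.2 hcard
  have hV : (fun j => col (π.symm j)) ∈ refinements row fun l k => a k l := by
    refine mem_refinements.2 fun l k => ?_
    rw [← hcard k l]
    refine Finset.card_equiv π.symm fun j => ?_
    simp [and_comm]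
  suffices h : π = fiberPerm (fun i => (col i, row (π i))) (fun j => (col (π.symm j), row j))
      (card_fiber_of_mem_refinements hW) (card_fiber_of_mem_refinements' hV)
      fun c => σ c.1 c.2 from
    ⟨⟨⟨_, hW⟩, ⟨_, hV⟩, fun c => ⟨σ c.1 c.2, hσ c.1 c.2⟩⟩, h.symm⟩
  refine eq_fiberPerm (f := fun i => (col i, row (π i))) (g := fun j => (col (π.symm j), row j))
    (card_fiber_of_mem_refinements hW) (card_fiber_of_mem_refinements' hV)
    (fun i => Prod.ext (congrArg col (π.symm_apply_apply i)) rfl) fun c => ?_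
  have hfe : e c.1 c.2 = fiberEmb (fun i => (col i, row (π i)))
      (card_fiber_of_mem_refinements hW) c := by
    refine DFunLike.coe_injective (eq_fiberEmb (fun i => (col i, row (π i)))
      (card_fiber_of_mem_refinements hW) c (fun x => ?_) (e c.1 c.2).strictMono)
    have : e c.1 c.2 x ∈ Set.range (e c.1 c.2) := Set.mem_range_self x
    rw [he] at this
    exact Prod.ext this.1 this.2
  rw [← hfe]
  exact hiso c.1 c.2

end Assemble

/-- `assemble` is a bijection from the triples of independent choices onto the gridded permutations.
-/
theorem ncard_griddedPerms (M : Matrix (Fin t) (Fin u) PermSet) (col : Fin n → Fin t)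
    (row : Fin n → Fin u) (a : Fin t → Fin u → ℕ) :
    (griddedPerms M col row a).ncard = #(refinements col a) *
      #(refinements row fun l k => a k l) * ∏ k, ∏ l, (cellMembers (M k l) (a k l)).ncard := by
  have hrange : Set.range (assemble (M := M) (col := col) (row := row) (a := a)) =
      griddedPerms M col row a :=
    Set.Subset.antisymm (Set.range_subset_iff.2 assemble_mem_griddedPerms)
      fun _ hπ => exists_assemble_eq hπ
  rw [← hrange, ← Set.image_univ, Set.ncard_image_of_injective _ assemble_injective,
    Set.ncard_univ, Nat.card_prod, Nat.card_prod, Nat.card_pi, Fintype.prod_prod_type, mul_assoc]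
  simp [Nat.card_coe_set_eq]

/-! ### From divisions to labels, and bounds for the grid class -/

/-- Every division comes from a labelling of the positions by the intervals. -/
theorem IsDivision.exists_label {s : ℕ} {d : Fin (s + 1) → ℕ} (hd : IsDivision s n d) :
    ∃ f : Fin n → Fin s, ∀ i k, f i = k ↔ (i : ℕ) ∈ Set.Ico (d k.castSucc) (d k.succ) := by
  obtain ⟨hm, h0, hl⟩ := hd
  have hex : ∀ i : Fin n, ∃ k : Fin s, (i : ℕ) ∈ Set.Ico (d k.castSucc) (d k.succ) := by
    intro i
    by_contra! hcon
    -- If no interval contains `i`, no division point can jump past it, and the last one would be at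
    -- most `i < n`.
    have : ∀ k : Fin (s + 1), d k ≤ i := by
      intro k
      induction k using Fin.induction with
      | zero => omega
      | succ k ih =>
        by_contra! hlt
        exact hcon k ⟨ih, hlt⟩
    have h1 := this (Fin.last s)
    have h2 := i.2
    omega
  choose f hf using hex
  refine ⟨f, fun i k => ⟨fun h => h ▸ hf i, fun h => ?_⟩⟩
  have h1 := hf i
  simp only [Set.mem_Ico] at h h1
  rcases lt_trichotomy (f i) k with hlt | heq | hlt
  · have : d (f i).succ ≤ d k.castSucc := hm (Fin.succ_le_castSucc_iff.2 hlt)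
    omega
  · exact heq
  · have : d k.succ ≤ d (f i).castSucc := hm (Fin.succ_le_castSucc_iff.2 hlt)
    omega

theorem card_label {s : ℕ} {d : Fin (s + 1) → ℕ} (hd : IsDivision s n d) {f : Fin n → Fin s}
    (hf : ∀ i k, f i = k ↔ (i : ℕ) ∈ Set.Ico (d k.castSucc) (d k.succ)) (k : Fin s) :
    #{i | f i = k} = d k.succ - d k.castSucc := by
  have hle : d k.succ ≤ n := hd.2.2 ▸ hd.1 (Fin.le_last _)
  rw [← Nat.card_Ico, ← Finset.card_map Fin.valEmbedding]
  congr 1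
  ext j
  simp only [Finset.mem_map, Finset.mem_filter, Finset.mem_univ, true_and, hf, Set.mem_Ico,
    Fin.valEmbedding_apply, Finset.mem_Ico]
  exact ⟨by rintro ⟨i, hi, rfl⟩; exact hi, fun hj => ⟨⟨j, by omega⟩, hj, rfl⟩⟩

theorem exists_isDivision {s : ℕ} (b : Fin s → ℕ) (hb : ∑ k, b k = n) :
    ∃ d, IsDivision s n d ∧ ∀ k, d k.succ - d k.castSucc = b k := by
  refine ⟨Fin.partialSum b, ⟨?_, Fin.partialSum_zero b, ?_⟩, fun k => ?_⟩
  · refine Fin.monotone_iff_le_succ.2 fun k => ?_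
    rw [Fin.partialSum_succ]
    exact Nat.le_add_right _ _
  · rw [← hb, Fin.partialSum]
    rw [List.take_of_length_le (by simp), List.sum_ofFn]
  · rw [Fin.partialSum_succ]
    simp

section Gridding

variable {M : Matrix (Fin t) (Fin u) PermSet} {c : Fin (t + 1) → ℕ} {r : Fin (u + 1) → ℕ}
  {col : Fin n → Fin t} {row : Fin n → Fin u} {a : Fin t → Fin u → ℕ}

theorem cell_eq (hcol : ∀ i k, col i = k ↔ (i : ℕ) ∈ Set.Ico (c k.castSucc) (c k.succ))
    (hrow : ∀ i k, row i = k ↔ (i : ℕ) ∈ Set.Ico (r k.castSucc) (r k.succ))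
    (π : Equiv.Perm (Fin n)) (k : Fin t) (l : Fin u) :
    cell π c r k l = {i | col i = k ∧ row (π i) = l} := by
  ext i
  simp only [cell, Set.mem_ofPred_eq, hcol, hrow]

theorem ncard_range_orderEmb {m : ℕ} (e : Fin m ↪o Fin n) : (Set.range e).ncard = m := by
  rw [← Set.image_univ, Set.ncard_image_of_injective _ e.injective]
  simp

theorem isGridding_of_mem_griddedPerms (hc : IsDivision t n c) (hr : IsDivision u n r)
    (hcol : ∀ i k, col i = k ↔ (i : ℕ) ∈ Set.Ico (c k.castSucc) (c k.succ))
    (hrow : ∀ i k, row i = k ↔ (i : ℕ) ∈ Set.Ico (r k.castSucc) (r k.succ))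
    {π : Equiv.Perm (Fin n)} (hπ : π ∈ griddedPerms M col row a) : IsGridding M π c r := by
  refine ⟨hc, hr, fun k l hne => ?_⟩
  rw [cell_eq hcol hrow] at hne ⊢
  obtain ⟨σ, hσ, e, he, hiso⟩ := hπ k l
  refine ⟨a k l, σ, e, hσ.resolve_left fun h0 => ?_, he, hiso⟩
  rw [← he, ← Set.ncard_pos, ncard_range_orderEmb] at hne
  omega

theorem mem_griddedPerms_of_isGridding
    (hcol : ∀ i k, col i = k ↔ (i : ℕ) ∈ Set.Ico (c k.castSucc) (c k.succ))
    (hrow : ∀ i k, row i = k ↔ (i : ℕ) ∈ Set.Ico (r k.castSucc) (r k.succ))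
    {π : Equiv.Perm (Fin n)} (hπ : IsGridding M π c r)
    (ha : ∀ k l, (cell π c r k l).ncard = a k l) : π ∈ griddedPerms M col row a := by
  intro k l
  rw [← cell_eq hcol hrow]
  have ha := ha k l
  rcases Set.eq_empty_or_nonempty (cell π c r k l) with h0 | hne
  · rw [h0, Set.ncard_empty] at ha
    rw [h0, ← ha]
    -- An empty cell is filled through the clause `m = 0` of `cellMembers`, as `M k l` may lack the
    -- empty permutation.
    exact ⟨1, Or.inl rfl, ⟨⟨Fin.elim0, fun x => x.elim0⟩, fun {x} => x.elim0⟩,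
      Set.range_eq_empty _, fun x => x.elim0⟩
  · obtain ⟨m, σ, e, hσ, he, hiso⟩ := hπ.2.2 k l hne
    obtain rfl : m = a k l := by rw [← ha, ← he, ncard_range_orderEmb]
    exact ⟨σ, Or.inr hσ, e, he, hiso⟩

end Gridding

/-- The union bound over the column divisions, row divisions and cell counts, all with entries in
`{0, …, n}`; this gives the exponent. -/
theorem ncard_grid_le (M : Matrix (Fin t) (Fin u) PermSet) (n : ℕ) {B : ℝ} (hB₀ : 0 ≤ B)
    (hB : ∀ (col : Fin n → Fin t) (row : Fin n → Fin u) (a : Fin t → Fin u → ℕ),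
      ((griddedPerms M col row a).ncard : ℝ) ≤ B) :
    ((Grid M n).ncard : ℝ) ≤ ((n : ℝ) + 1) ^ (t + 1 + (u + 1) + t * u) * B := by
  let S : (Fin (t + 1) → Fin (n + 1)) × (Fin (u + 1) → Fin (n + 1)) ×
      (Fin t × Fin u → Fin (n + 1)) → Set (Equiv.Perm (Fin n)) := fun x =>
    {π | IsGridding M π (fun k => x.1 k) (fun k => x.2.1 k) ∧
      ∀ k l, (cell π (fun k => (x.1 k : ℕ)) (fun k => x.2.1 k) k l).ncard = x.2.2 (k, l)}
  have hsub : Grid M n ⊆ ⋃ x, S x := by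
    rintro π ⟨c, r, h⟩
    have hc : ∀ k, c k < n + 1 := fun k => Nat.lt_succ_of_le (h.1.2.2 ▸ h.1.1 (Fin.le_last k))
    have hr : ∀ k, r k < n + 1 := fun k =>
      Nat.lt_succ_of_le (h.2.1.2.2 ▸ h.2.1.1 (Fin.le_last k))
    have ha : ∀ p : Fin t × Fin u, (cell π c r p.1 p.2).ncard < n + 1 := fun p =>
      Nat.lt_succ_of_le ((Set.ncard_le_card _).trans_eq (by simp))
    exact Set.mem_iUnion.2 ⟨⟨fun k => ⟨c k, hc k⟩, fun k => ⟨r k, hr k⟩, fun p => ⟨_, ha p⟩⟩,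
      h, fun k l => rfl⟩
  have hS : ∀ x, ((S x).ncard : ℝ) ≤ B := by
    intro x
    -- A member of `S x` certifies that the sequences in `x` are divisions, so that labels exist.
    rcases Set.eq_empty_or_nonempty (S x) with h0 | ⟨π₀, hπ₀, -⟩
    · rw [h0, Set.ncard_empty]
      simpa using hB₀
    · obtain ⟨col, hcol⟩ := hπ₀.1.exists_label
      obtain ⟨row, hrow⟩ := hπ₀.2.1.exists_label
      refine le_trans ?_ (hB col row fun k l => x.2.2 (k, l))
      exact_mod_cast Set.ncard_le_ncard (fun π (hπ : π ∈ S x) =>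
        mem_griddedPerms_of_isGridding (c := fun k => (x.1 k : ℕ)) (r := fun k => (x.2.1 k : ℕ))
          hcol hrow hπ.1 hπ.2) (Set.toFinite _)
  calc ((Grid M n).ncard : ℝ) ≤ ((⋃ x, S x).ncard : ℝ) := by
        exact_mod_cast Set.ncard_le_ncard hsub (Set.toFinite _)
    _ ≤ ((∑ x, (S x).ncard : ℕ) : ℝ) := by
        exact_mod_cast Set.ncard_iUnion_le_of_fintype S
    _ ≤ ∑ _x, B := by
        push_cast
        exact Finset.sum_le_sum fun x _ => hS x
    _ = _ := by
        simp [pow_add, mul_assoc, pow_mul]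

theorem exists_griddedPerms_subset_grid (M : Matrix (Fin t) (Fin u) PermSet)
    (a : Fin t → Fin u → ℕ) (ha : ∑ k, ∑ l, a k l = n) :
    ∃ (col : Fin n → Fin t) (row : Fin n → Fin u), (∀ k, #{i | col i = k} = ∑ l, a k l) ∧
      (∀ l, #{i | row i = l} = ∑ k, a k l) ∧ griddedPerms M col row a ⊆ Grid M n := by
  obtain ⟨c, hc, hc'⟩ := exists_isDivision (fun k => ∑ l, a k l) ha
  obtain ⟨r, hr, hr'⟩ := exists_isDivision (fun l => ∑ k, a k l)
    (Finset.sum_comm.trans ha)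
  obtain ⟨col, hcol⟩ := hc.exists_label
  obtain ⟨row, hrow⟩ := hr.exists_label
  exact ⟨col, row, fun k => (card_label hc hcol k).trans (hc' k),
    fun k => (card_label hr hrow k).trans (hr' k),
    fun π hπ => ⟨c, r, isGridding_of_mem_griddedPerms hc hr hcol hrow hπ⟩⟩

end GridClass

/-! ### Spectral theory of the Gram matrix -/

namespace GridClass

open Matrix Filter Topology

section Spectral

variable {κ ι : Type*} [Fintype κ] [Fintype ι] {Γ : Matrix κ ι ℝ}

theorem dotProduct_mulVec_gram (x y : ι → ℝ) : x ⬝ᵥ (Γᵀ * Γ) *ᵥ y = Γ *ᵥ x ⬝ᵥ Γ *ᵥ y := by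
  rw [← mulVec_mulVec, dotProduct_mulVec, vecMul_transpose]

theorem dotProduct_self_nonneg (x : ι → ℝ) : 0 ≤ x ⬝ᵥ x :=
  Finset.sum_nonneg fun i _ => mul_self_nonneg (x i)

/-- Perron's argument, without irreducibility: maximize the quadratic form on the unit sphere. As
`Γ` is nonnegative, taking absolute values of a maximizer does not decrease the form. -/
theorem exists_nonneg_eigenvector [DecidableEq ι] [Nonempty ι] (hΓ : ∀ k l, 0 ≤ Γ k l) :
    ∃ (ρ : ℝ) (v : ι → ℝ), 0 ≤ ρ ∧ (∀ l, 0 ≤ v l) ∧ v ⬝ᵥ v = 1 ∧ (Γᵀ * Γ) *ᵥ v = ρ • v ∧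
      ∀ x, Γ *ᵥ x ⬝ᵥ Γ *ᵥ x ≤ ρ * (x ⬝ᵥ x) := by
  let K : Set (ι → ℝ) := {x | x ⬝ᵥ x = 1}
  have hKc : IsCompact K := by
    refine Metric.isCompact_of_isClosed_isBounded ?_ ?_
    · exact isClosed_eq (by unfold dotProduct; fun_prop) continuous_const
    · refine (Metric.isBounded_closedBall (x := (0 : ι → ℝ)) (r := 1)).subset fun x hx => ?_
      rw [mem_closedBall_zero_iff, pi_norm_le_iff_of_nonneg zero_le_one]
      intro i
      have h1 : x i * x i ≤ x ⬝ᵥ x :=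
        Finset.single_le_sum (f := fun i => x i * x i) (fun i _ => mul_self_nonneg _)
          (Finset.mem_univ i)
      have hx : x ⬝ᵥ x = 1 := hx
      rw [Real.norm_eq_abs]
      exact abs_le_one_iff_mul_self_le_one.2 (h1.trans hx.le)
  have hKn : K.Nonempty := ⟨Pi.single (Classical.arbitrary ι) 1, by simp [K]⟩
  obtain ⟨x₀, hx₀, hmax⟩ := hKc.exists_isMaxOn hKn
    (f := fun x => Γ *ᵥ x ⬝ᵥ Γ *ᵥ x) (by unfold mulVec dotProduct; fun_prop)
  have hx₀ : x₀ ⬝ᵥ x₀ = 1 := hx₀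
  set ρ := Γ *ᵥ x₀ ⬝ᵥ Γ *ᵥ x₀ with hρ
  have hbound : ∀ x, Γ *ᵥ x ⬝ᵥ Γ *ᵥ x ≤ ρ * (x ⬝ᵥ x) := by
    intro x
    rcases (dotProduct_self_nonneg x).eq_or_lt with h0 | hpos
    · obtain rfl := dotProduct_self_eq_zero.1 h0.symm
      simp
    · have hr : (√(x ⬝ᵥ x)) * √(x ⬝ᵥ x) = x ⬝ᵥ x := Real.mul_self_sqrt hpos.le
      have hr0 : 0 < √(x ⬝ᵥ x) := Real.sqrt_pos.2 hpos
      have h1 : (√(x ⬝ᵥ x))⁻¹ • x ∈ K := by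
        simp only [K, Set.mem_ofPred_eq, smul_dotProduct, dotProduct_smul, smul_eq_mul]
        rw [← mul_assoc, ← mul_inv, hr, inv_mul_cancel₀ hpos.ne']
      have h2 : _ ≤ ρ := hmax h1
      simp only [mulVec_smul, smul_dotProduct, dotProduct_smul, smul_eq_mul] at h2
      rw [← mul_assoc, ← mul_inv, hr, inv_mul_le_iff₀ hpos] at h2
      linarith
  let v : ι → ℝ := fun l => |x₀ l|
  have hv : v ⬝ᵥ v = 1 := by
    rw [← hx₀]
    exact Finset.sum_congr rfl fun l _ => abs_mul_abs_self _
  have hρv : ρ ≤ Γ *ᵥ v ⬝ᵥ Γ *ᵥ v := by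
    refine Finset.sum_le_sum fun k _ => ?_
    rw [← abs_mul_abs_self ((Γ *ᵥ x₀) k)]
    have : |(Γ *ᵥ x₀) k| ≤ (Γ *ᵥ v) k := by
      refine (Finset.abs_sum_le_sum_abs _ _).trans_eq (Finset.sum_congr rfl fun l _ => ?_)
      rw [abs_mul, abs_of_nonneg (hΓ k l)]
    exact mul_self_le_mul_self (abs_nonneg _) this
  have hρv' : Γ *ᵥ v ⬝ᵥ Γ *ᵥ v = ρ := le_antisymm ((hbound v).trans_eq (by simp [hv])) hρv
  refine ⟨ρ, v, dotProduct_self_nonneg _, fun l => abs_nonneg _, hv, ?_, hbound⟩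
  -- A zero of the quadratic form of a positive semidefinite matrix lies in its kernel; this is the
  -- eigenvector equation.
  have hpsd : (ρ • (1 : Matrix ι ι ℝ) - Γᵀ * Γ).PosSemidef := by
    refine PosSemidef.of_dotProduct_mulVec_nonneg ?_ fun x => ?_
    · simp [IsHermitian]
    · simp only [star_trivial, sub_mulVec, smul_mulVec, one_mulVec, dotProduct_sub,
        dotProduct_smul, smul_eq_mul, dotProduct_mulVec_gram]
      linarith [hbound x]
  have hz := (hpsd.dotProduct_mulVec_zero_iff v).1 (by
    simp only [star_trivial, sub_mulVec, smul_mulVec, one_mulVec, dotProduct_sub,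
        dotProduct_smul, smul_eq_mul, dotProduct_mulVec_gram, hv, hρv']
    ring)
  rw [sub_mulVec, smul_mulVec, one_mulVec, sub_eq_zero] at hz
  exact hz.symm

theorem isGreatest_eigenvalues_gram [DecidableEq ι] {ρ : ℝ} {v : ι → ℝ} (hv : v ⬝ᵥ v = 1)
    (hρ : (Γᵀ * Γ) *ᵥ v = ρ • v) (hb : ∀ x, Γ *ᵥ x ⬝ᵥ Γ *ᵥ x ≤ ρ * (x ⬝ᵥ x)) :
    IsGreatest {μ : ℝ | Module.End.HasEigenvalue (toLin' (Γᵀ * Γ)) μ} ρ := by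
  constructor
  · refine Module.End.hasEigenvalue_of_hasEigenvector (x := v)
      ⟨Module.End.mem_eigenspace_iff.2 (by simpa using hρ), ?_⟩
    rintro rfl
    simp at hv
  · intro μ hμ
    obtain ⟨x, hx⟩ := Module.End.HasEigenvalue.exists_hasEigenvector hμ
    have hx' : (Γᵀ * Γ) *ᵥ x = μ • x := by simpa using hx.apply_eq_smul
    have hpos : 0 < x ⬝ᵥ x := (dotProduct_self_nonneg x).lt_of_ne'
      fun h => hx.2 (dotProduct_self_eq_zero.1 h)
    have := hb x
    rw [← dotProduct_mulVec_gram, hx', dotProduct_smul, smul_eq_mul] at this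
    exact le_of_mul_le_mul_right this hpos

/-- Nonzero eigenvalues pass between the two Gram matrices by applying `Γ` or `Γᵀ` to eigenvectors.
For `ρ = 0` the matrix `Γ` vanishes and any nonzero vector serves. -/
theorem isGreatest_eigenvalues_gram_transpose [DecidableEq ι] [DecidableEq κ] [Nonempty κ] {ρ : ℝ}
    (hρ₀ : 0 ≤ ρ) {v : ι → ℝ} (hv : v ⬝ᵥ v = 1)
    (hρ : (Γᵀ * Γ) *ᵥ v = ρ • v) (hb : ∀ x, Γ *ᵥ x ⬝ᵥ Γ *ᵥ x ≤ ρ * (x ⬝ᵥ x)) :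
    IsGreatest {μ : ℝ | Module.End.HasEigenvalue (toLin' (Γ * Γᵀ)) μ} ρ := by
  constructor
  · rcases hρ₀.eq_or_lt with rfl | hpos
    · have h0 : ∀ x, Γ *ᵥ x = 0 := fun x => dotProduct_self_eq_zero.1
        (le_antisymm (by simpa using hb x) (dotProduct_self_nonneg _))
      refine Module.End.hasEigenvalue_of_hasEigenvector (x := fun _ => 1)
        ⟨Module.End.mem_eigenspace_iff.2 ?_, ?_⟩
      · simp [h0]
      · exact fun h => one_ne_zero (congrFun h (Classical.arbitrary κ))
    · refine Module.End.hasEigenvalue_of_hasEigenvector (x := Γ *ᵥ v)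
        ⟨Module.End.mem_eigenspace_iff.2 ?_, fun h => ?_⟩
      · rw [toLin'_apply, ← mulVec_mulVec, mulVec_mulVec v, hρ, mulVec_smul]
      · have := dotProduct_mulVec_gram (Γ := Γ) v v
        rw [hρ, h, dotProduct_smul, hv] at this
        simp [hpos.ne'] at this
  · intro μ hμ
    by_contra! hlt
    have hμ0 : 0 < μ := hρ₀.trans_lt hlt
    obtain ⟨x, hx⟩ := Module.End.HasEigenvalue.exists_hasEigenvector hμ
    have hx' : Γ *ᵥ (Γᵀ *ᵥ x) = μ • x := by simpa using hx.apply_eq_smul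
    refine hlt.not_ge ((isGreatest_eigenvalues_gram hv hρ hb).2 ?_)
    refine Module.End.hasEigenvalue_of_hasEigenvector (x := Γᵀ *ᵥ x)
        ⟨Module.End.mem_eigenspace_iff.2 ?_, fun h => hx.2 ?_⟩
    · rw [toLin'_apply, ← mulVec_mulVec, hx', mulVec_smul]
    · rw [h, mulVec_zero] at hx'
      exact (smul_eq_zero.1 hx'.symm).resolve_left hμ0.ne'

/-- With `y = Γᵀ Γ x`, Cauchy–Schwarz applied to `y ⬝ᵥ y = Γ y ⬝ᵥ Γ x` leaves a factor `y ⬝ᵥ y` to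
cancel. -/
theorem dotProduct_gram_mulVec_self_le {ρ : ℝ} (hρ₀ : 0 ≤ ρ)
    (hb : ∀ x, Γ *ᵥ x ⬝ᵥ Γ *ᵥ x ≤ ρ * (x ⬝ᵥ x)) (x : ι → ℝ) :
    (Γᵀ * Γ) *ᵥ x ⬝ᵥ (Γᵀ * Γ) *ᵥ x ≤ ρ ^ 2 * (x ⬝ᵥ x) := by
  set y := (Γᵀ * Γ) *ᵥ x with hy
  have h1 : y ⬝ᵥ y = Γ *ᵥ y ⬝ᵥ Γ *ᵥ x := by
    conv_lhs => rw [hy]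
    rw [← hy, dotProduct_mulVec_gram]
  have h2 : (Γ *ᵥ y ⬝ᵥ Γ *ᵥ x) ^ 2 ≤ (Γ *ᵥ y ⬝ᵥ Γ *ᵥ y) * (Γ *ᵥ x ⬝ᵥ Γ *ᵥ x) := by
    have := Finset.sum_mul_sq_le_sq_mul_sq Finset.univ (Γ *ᵥ y) (Γ *ᵥ x)
    simpa [dotProduct, sq] using this
  rw [← h1] at h2
  have h3 : (y ⬝ᵥ y) ^ 2 ≤ (ρ * (y ⬝ᵥ y)) * (ρ * (x ⬝ᵥ x)) :=
    h2.trans (mul_le_mul (hb y) (hb x) (dotProduct_self_nonneg _)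
      (mul_nonneg hρ₀ (dotProduct_self_nonneg _)))
  rcases (dotProduct_self_nonneg y).eq_or_lt with h0 | hpos
  · rw [← h0]
    exact mul_nonneg (sq_nonneg _) (dotProduct_self_nonneg _)
  · refine le_of_mul_le_mul_right ?_ hpos
    nlinarith

/-- The top eigenvector may have zero entries, so a positive vector is made from the truncated
Neumann series `∑ j < N, τ⁻ʲ Bʲ 1`. Applying `B` shifts the series; the new tail is at most the
dropped term `1` once `B ^ N *ᵥ 1 ≤ τ ^ N`, which holds for large `N` because `ρ < τ`. -/
theorem exists_pos_mulVec_le [DecidableEq ι] (hΓ : ∀ k l, 0 ≤ Γ k l) {ρ τ : ℝ} (hρ₀ : 0 ≤ ρ)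
    (hb : ∀ x, Γ *ᵥ x ⬝ᵥ Γ *ᵥ x ≤ ρ * (x ⬝ᵥ x)) (hτ : ρ < τ) :
    ∃ v : ι → ℝ, (∀ l, 0 < v l) ∧ ∀ l, ((Γᵀ * Γ) *ᵥ v) l ≤ τ * v l := by
  have hτ0 : 0 < τ := hρ₀.trans_lt hτ
  set B := Γᵀ * Γ with hB
  have hB0 : ∀ i j, 0 ≤ B i j := fun i j =>
    Finset.sum_nonneg fun k _ => mul_nonneg (hΓ k i) (hΓ k j)
  let x : ℕ → ι → ℝ := fun n => (B ^ n) *ᵥ 1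
  have hx0 : x 0 = 1 := by simp [x]
  have hxs : ∀ n, x (n + 1) = B *ᵥ x n := fun n => by simp [x, pow_succ', mulVec_mulVec]
  have hxn : ∀ n l, 0 ≤ x n l := by
    intro n
    induction n with
    | zero => simp [hx0]
    | succ n ih =>
      intro l
      rw [hxs]
      exact Finset.sum_nonneg fun j _ => mul_nonneg (hB0 l j) (ih j)
  have hxb : ∀ n, x n ⬝ᵥ x n ≤ (ρ ^ 2) ^ n * Fintype.card ι := by
    intro n
    induction n with
    | zero => simp [hx0]
    | succ n ih =>
      rw [hxs]
      refine (dotProduct_gram_mulVec_self_le hρ₀ hb _).trans ?_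
      rw [pow_succ' (ρ ^ 2), mul_assoc]
      exact mul_le_mul_of_nonneg_left ih (sq_nonneg _)
  obtain ⟨N, hN, hN0⟩ : ∃ N : ℕ, ((ρ / τ) ^ 2) ^ N * Fintype.card ι < 1 ∧ 0 < N := by
    have h1 : (ρ / τ) ^ 2 < 1 := pow_lt_one₀ (div_nonneg hρ₀ hτ0.le) ((div_lt_one hτ0).2 hτ)
      two_ne_zero
    have := (tendsto_pow_atTop_nhds_zero_of_lt_one (sq_nonneg (ρ / τ)) h1).mul_const
      (Fintype.card ι : ℝ)
    rw [zero_mul] at this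
    exact ((this.eventually_lt_const one_pos).and (eventually_gt_atTop 0)).exists
  have hxN : ∀ l, x N l ≤ τ ^ N := by
    intro l
    refine abs_le_of_sq_le_sq' ?_ (by positivity) |>.2
    have h1 : x N l * x N l ≤ x N ⬝ᵥ x N :=
      Finset.single_le_sum (f := fun i => x N i * x N i) (fun i _ => mul_self_nonneg _)
        (Finset.mem_univ l)
    have h2 := h1.trans (hxb N)
    rw [div_pow, div_pow, div_mul_eq_mul_div, div_lt_one (by positivity)] at hN
    calc x N l ^ 2 = x N l * x N l := sq _
      _ ≤ (τ ^ 2) ^ N := h2.trans hN.le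
      _ = (τ ^ N) ^ 2 := by ring
  let v : ℕ → ι → ℝ := fun n => ∑ j ∈ Finset.range n, (τ⁻¹) ^ j • x j
  have hBv : ∀ n l, (B *ᵥ v n) l = τ * (v n l - 1 + (τ⁻¹) ^ n * x n l) := by
    intro n l
    induction n with
    | zero => simp [v, hx0]
    | succ n ih =>
      have hv : v (n + 1) = v n + (τ⁻¹) ^ n • x n := Finset.sum_range_succ _ _
      rw [hv, mulVec_add, mulVec_smul, ← hxs, Pi.add_apply, ih]
      simp only [Pi.add_apply, Pi.smul_apply, smul_eq_mul, pow_succ]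
      field_simp
      ring
  refine ⟨v N, fun l => ?_, fun l => ?_⟩
  · have h1 : v N l = ∑ j ∈ Finset.range N, (τ⁻¹) ^ j * x j l := by
      simp [v, Finset.sum_apply]
    rw [h1]
    refine Finset.sum_pos' (fun j _ => mul_nonneg (by positivity) (hxn j l))
      ⟨0, by simpa using hN0, ?_⟩
    simp [hx0]
  · rw [hBv]
    have h1 : (τ⁻¹) ^ N * x N l ≤ 1 := by
      rw [inv_pow, inv_mul_le_iff₀ (by positivity), mul_one]
      exact hxN l
    exact mul_le_mul_of_nonneg_left (by linarith) hτ0.le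

/-- All the inequalities can be had with slack, and there are finitely many, so they survive a small
`δ` in `w` and then a small `ε` added to each entry of `Γ`. The strict gap between `Γ` and `Γ'` will
absorb the subexponential factors of the class counts. -/
theorem exists_strict_subeigenvectors [DecidableEq ι] (hΓ : ∀ k l, 0 ≤ Γ k l) {ρ τ : ℝ}
    (hρ₀ : 0 ≤ ρ) (hb : ∀ x, Γ *ᵥ x ⬝ᵥ Γ *ᵥ x ≤ ρ * (x ⬝ᵥ x)) (hτ : ρ < τ) :
    ∃ (Γ' : Matrix κ ι ℝ) (v : ι → ℝ) (w : κ → ℝ), (∀ k l, Γ k l < Γ' k l) ∧ (∀ l, 0 < v l) ∧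
      (∀ k, 0 < w k) ∧ (∀ k, ∑ l, Γ' k l * v l ≤ √τ * w k) ∧
      ∀ l, ∑ k, Γ' k l * w k ≤ √τ * v l := by
  obtain ⟨τ₁, hτ₁, hτ₁'⟩ := exists_between hτ
  obtain ⟨v, hv, hBv⟩ := exists_pos_mulVec_le hΓ hρ₀ hb hτ₁
  have hs : 0 < √τ := Real.sqrt_pos.2 (hρ₀.trans_lt hτ)
  have hss : √τ * √τ = τ := Real.mul_self_sqrt (hρ₀.trans hτ.le)
  set s := √τ with hs_def
  -- The shift `δ` keeps `w` positive where `Γ` has a zero row.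
  let w : ℝ → κ → ℝ := fun δ k => (∑ l, Γ k l * v l) / s + δ
  have hδ : ∀ᶠ δ in 𝓝[>] (0 : ℝ), ∀ l, ∑ k, Γ k l * w δ k < s * v l := by
    refine eventually_all.2 fun l => nhdsWithin_le_nhds ?_
    refine Tendsto.eventually_lt_const (v := ∑ k, Γ k l * w 0 k) ?_
      (Continuous.tendsto (by fun_prop) 0)
    have h1 : ∑ k, Γ k l * w 0 k = ((Γᵀ * Γ) *ᵥ v) l / s := by
      rw [← mulVec_mulVec]
      simp [w, mulVec, dotProduct, Finset.sum_div, mul_div_assoc]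
    rw [h1, div_lt_iff₀ hs]
    calc _ ≤ τ₁ * v l := hBv l
      _ < τ * v l := mul_lt_mul_of_pos_right hτ₁' (hv l)
      _ = s * v l * s := by rw [← hss]; ring
  obtain ⟨δ, hδ, hδ0⟩ := (hδ.and self_mem_nhdsWithin).exists
  have hδ0 : 0 < δ := hδ0
  have h1 : ∀ k, ∑ l, Γ k l * v l < s * w δ k := by
    intro k
    have : s * w δ k = ∑ l, Γ k l * v l + s * δ := by
      simp only [w]
      field_simp
    rw [this]
    exact lt_add_of_pos_right _ (mul_pos hs hδ0)
  have hw : ∀ k, 0 < w δ k := fun k => add_pos_of_nonneg_of_pos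
    (div_nonneg (Finset.sum_nonneg fun l _ => mul_nonneg (hΓ k l) (hv l).le) hs.le) hδ0
  have hε1 : ∀ᶠ ε in 𝓝[>] (0 : ℝ), ∀ k, ∑ l, (Γ k l + ε) * v l < s * w δ k := by
    refine eventually_all.2 fun k => nhdsWithin_le_nhds ?_
    refine Tendsto.eventually_lt_const (v := ∑ l, (Γ k l + 0) * v l) ?_
      (Continuous.tendsto (by fun_prop) 0)
    simpa using h1 k
  have hε2 : ∀ᶠ ε in 𝓝[>] (0 : ℝ), ∀ l, ∑ k, (Γ k l + ε) * w δ k < s * v l := by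
    refine eventually_all.2 fun l => nhdsWithin_le_nhds ?_
    refine Tendsto.eventually_lt_const (v := ∑ k, (Γ k l + 0) * w δ k) ?_
      (Continuous.tendsto (by fun_prop) 0)
    simpa using hδ l
  obtain ⟨ε, ⟨h2, h3⟩, hε⟩ := ((hε1.and hε2).and self_mem_nhdsWithin).exists
  exact ⟨fun k l => Γ k l + ε, v, w δ, fun k l => lt_add_of_pos_right _ hε, hv, hw,
    fun k => (h2 k).le, fun l => (h3 l).le⟩

end Spectral

end GridClass

/-! ### The upper bound -/

namespace GridClass

open Matrix Filter Topology

theorem HasProperGrowthRate.nonneg {C : PermSet} {g : ℝ} (h : HasProperGrowthRate C g) : 0 ≤ g :=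
  ge_of_tendsto h (Eventually.of_forall fun _ => by positivity)

theorem HasProperGrowthRate.exists_bound {C : PermSet} {g γ : ℝ} (h : HasProperGrowthRate C g)
    (hγ : √g < γ) :
    ∃ D : ℝ, 0 ≤ D ∧ ∀ m, ((cellMembers C m).ncard : ℝ) ≤ D * (γ ^ 2) ^ m := by
  have hγ0 : 0 < γ := (Real.sqrt_nonneg g).trans_lt hγ
  obtain ⟨N, hN⟩ := eventually_atTop.1
    (h.eventually_lt_const ((Real.sqrt_lt' hγ0).1 hγ))
  have hnn : ∀ m, 0 ≤ ((cellMembers C m).ncard : ℝ) / (γ ^ 2) ^ m := fun m => by positivity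
  have hS : 0 ≤ ∑ m ∈ Finset.range (N + 1), ((cellMembers C m).ncard : ℝ) / (γ ^ 2) ^ m :=
    Finset.sum_nonneg fun m _ => hnn m
  -- The sum takes care of `m ≤ N`, including the empty filling at `m = 0`; the `1` takes care of
  -- larger `m`.
  refine ⟨1 + ∑ m ∈ Finset.range (N + 1), ((cellMembers C m).ncard : ℝ) / (γ ^ 2) ^ m,
    by positivity, fun m => ?_⟩
  rw [← div_le_iff₀ (by positivity)]
  by_cases hm : m ∈ Finset.range (N + 1)
  · have := Finset.single_le_sum (f := fun m => ((cellMembers C m).ncard : ℝ) / (γ ^ 2) ^ m)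
      (fun m _ => hnn m) hm
    linarith
  · have hm' : N + 1 ≤ m := by simpa using hm
    have hm0 : m ≠ 0 := by omega
    have hC : cellMembers C m = C m := by
      ext σ
      simp [cellMembers, hm0]
    have h1 := (hN m (by omega)).le
    rw [one_div, Real.rpow_inv_le_iff_of_pos (by positivity) (by positivity)
      (by positivity), Real.rpow_natCast] at h1
    have h2 : ((cellMembers C m).ncard : ℝ) / (γ ^ 2) ^ m ≤ 1 := by
      rw [div_le_one (by positivity), hC]
      exact h1
    linarith

theorem card_refinements_le {α κ ι : Type*} [Fintype α] [DecidableEq α] [Fintype κ]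
    [DecidableEq κ] [Fintype ι] [DecidableEq ι] {col : α → κ} {a : κ → ι → ℕ}
    {Γ : κ → ι → ℝ} {v : ι → ℝ} {w : κ → ℝ} {s : ℝ} (hΓ : ∀ k l, 0 ≤ Γ k l) (hv : ∀ l, 0 ≤ v l)
    (hne : (refinements col a).Nonempty) (h : ∀ k, ∑ l, Γ k l * v l ≤ s * w k) :
    ((refinements col a).card : ℝ) * ((∏ k, ∏ l, Γ k l ^ a k l) * ∏ k, ∏ l, v l ^ a k l) ≤
      s ^ Fintype.card α * ∏ k, ∏ l, w k ^ a k l := by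
  -- Some word is needed to know the fiber sizes of `col`, which turn the product of `w (col i)`
  -- into a monomial with exponents `a k l`.
  obtain ⟨W, hW⟩ := hne
  calc _ = ((refinements col a).card : ℝ) * ∏ k, ∏ l, (Γ k l * v l) ^ a k l := by
        simp only [mul_pow, Finset.prod_mul_distrib]
    _ ≤ ∏ i, ∑ l, Γ (col i) l * v l :=
        card_refinements_mul_le (fun k l => Γ k l * v l) fun k l => mul_nonneg (hΓ k l) (hv l)
    _ ≤ ∏ i, s * w (col i) := Finset.prod_le_prod
        (fun i _ => Finset.sum_nonneg fun l _ => mul_nonneg (hΓ _ _) (hv l)) fun i _ => h _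
    _ = _ := by
        rw [← prod_of_mem_refinements hW fun k _ => w k, Finset.prod_mul_distrib]
        simp

variable {t u : ℕ} {M : Matrix (Fin t) (Fin u) PermSet}

/-- The bound on row words carries the `v`-monomial on the left and the `w`-monomial on the right;
the bound on column words carries them the other way round. Their product is free of both, and its
factor `P ^ 2` pays for the cells. -/
theorem ncard_griddedPerms_le {Γ : Matrix (Fin t) (Fin u) ℝ} {v : Fin u → ℝ} {w : Fin t → ℝ}
    {τ : ℝ} {D : Fin t → Fin u → ℝ} (hτ : 0 ≤ τ) (hΓ : ∀ k l, 0 < Γ k l) (hv : ∀ l, 0 < v l)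
    (hw : ∀ k, 0 < w k) (hΓv : ∀ k, ∑ l, Γ k l * v l ≤ √τ * w k)
    (hΓw : ∀ l, ∑ k, Γ k l * w k ≤ √τ * v l) (hD : ∀ k l, 0 ≤ D k l)
    (hM : ∀ k l m, ((cellMembers (M k l) m).ncard : ℝ) ≤ D k l * (Γ k l ^ 2) ^ m) {n : ℕ}
    (col : Fin n → Fin t) (row : Fin n → Fin u) (a : Fin t → Fin u → ℕ) :
    ((griddedPerms M col row a).ncard : ℝ) ≤ (∏ k, ∏ l, D k l) * τ ^ n := by
  have hD' : 0 ≤ ∏ k, ∏ l, D k l :=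
    Finset.prod_nonneg fun k _ => Finset.prod_nonneg fun l _ => hD k l
  have hRHS : 0 ≤ (∏ k, ∏ l, D k l) * τ ^ n := by positivity
  rw [ncard_griddedPerms]
  rcases (refinements col a).eq_empty_or_nonempty with h0 | h1
  · simpa [h0] using hRHS
  rcases (refinements row fun l k => a k l).eq_empty_or_nonempty with h0 | h2
  · simpa [h0] using hRHS
  have e1 := card_refinements_le (fun k l => (hΓ k l).le) (fun l => (hv l).le) h1 hΓv
  have e2 := card_refinements_le (Γ := fun l k => Γ k l) (fun l k => (hΓ k l).le)
    (fun k => (hw k).le) h2 hΓw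
  rw [Finset.prod_comm, Finset.prod_comm (f := fun l k => w k ^ a k l),
    Finset.prod_comm (f := fun l k => v l ^ a k l)] at e2
  have e3 : ∏ k, ∏ l, ((cellMembers (M k l) (a k l)).ncard : ℝ) ≤
      (∏ k, ∏ l, D k l) * (∏ k, ∏ l, Γ k l ^ a k l) ^ 2 := by
    calc _ ≤ ∏ k, ∏ l, D k l * (Γ k l ^ 2) ^ a k l :=
          Finset.prod_le_prod (fun k _ => Finset.prod_nonneg fun l _ => by positivity)
            fun k _ => Finset.prod_le_prod (fun l _ => by positivity) fun l _ => hM k l _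
      _ = _ := by
          simp only [Finset.prod_mul_distrib, ← Finset.prod_pow, ← pow_mul, mul_comm 2]
  have hP : 0 < ∏ k, ∏ l, Γ k l ^ a k l :=
    Finset.prod_pos fun k _ => Finset.prod_pos fun l _ => pow_pos (hΓ k l) _
  have hX : 0 < ∏ k : Fin t, ∏ l, v l ^ a k l :=
    Finset.prod_pos fun k _ => Finset.prod_pos fun l _ => pow_pos (hv l) _
  have hY : 0 < ∏ k, ∏ l : Fin u, w k ^ a k l :=
    Finset.prod_pos fun k _ => Finset.prod_pos fun l _ => pow_pos (hw k) _
  push_cast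
  generalize (∏ k, ∏ l, Γ k l ^ a k l) = P at *
  generalize (∏ k : Fin t, ∏ l, v l ^ a k l) = X at *
  generalize (∏ k, ∏ l : Fin u, w k ^ a k l) = Y at *
  have hR : 0 ≤ ((refinements col a).card : ℝ) := by positivity
  have hR' : 0 ≤ ((refinements row fun l k => a k l).card : ℝ) := by positivity
  generalize ((refinements col a).card : ℝ) = R at *
  generalize ((refinements row fun l k => a k l).card : ℝ) = R' at *
  rw [Fintype.card_fin] at e1 e2
  have e4 : R * R' * P ^ 2 ≤ τ ^ n := by
    refine le_of_mul_le_mul_right ?_ (mul_pos hX hY)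
    calc R * R' * P ^ 2 * (X * Y) = R * (P * X) * (R' * (P * Y)) := by ring
      _ ≤ (√τ ^ n * Y) * (√τ ^ n * X) := mul_le_mul e1 e2 (by positivity) (by positivity)
      _ = (√τ * √τ) ^ n * (X * Y) := by ring
      _ = τ ^ n * (X * Y) := by rw [Real.mul_self_sqrt hτ]
  calc _ ≤ R * R' * ((∏ k, ∏ l, D k l) * P ^ 2) :=
        mul_le_mul_of_nonneg_left e3 (mul_nonneg hR hR')
    _ = (∏ k, ∏ l, D k l) * (R * R' * P ^ 2) := by ring
    _ ≤ _ := mul_le_mul_of_nonneg_left e4 hD'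

theorem eventually_rpow_grid_lt {g Γ : Matrix (Fin t) (Fin u) ℝ}
    (hg : ∀ k l, HasProperGrowthRate (M k l) (g k l)) (hΓ : ∀ k l, Γ k l = √(g k l)) {ρ τ : ℝ}
    (hρ₀ : 0 ≤ ρ) (hb : ∀ x, Γ *ᵥ x ⬝ᵥ Γ *ᵥ x ≤ ρ * (x ⬝ᵥ x)) (hτ : ρ < τ) :
    ∀ᶠ n : ℕ in atTop, ((Grid M n).ncard : ℝ) ^ (1 / (n : ℝ)) < τ := by
  -- The count is bounded with `τ₁`; passing to `τ₂` absorbs the polynomial factor, and `τ₂ < τ`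
  -- makes the final inequality strict.
  obtain ⟨τ₂, hτ₂, hτ₂'⟩ := exists_between hτ
  obtain ⟨τ₁, hτ₁, hτ₁'⟩ := exists_between hτ₂
  have hΓ0 : ∀ k l, 0 ≤ Γ k l := fun k l => hΓ k l ▸ Real.sqrt_nonneg _
  have hτ10 : 0 < τ₁ := hρ₀.trans_lt hτ₁
  have hτ20 : 0 < τ₂ := hρ₀.trans_lt hτ₂
  obtain ⟨Γ', v, w, hΓΓ', hv, hw, hΓv, hΓw⟩ := exists_strict_subeigenvectors hΓ0 hρ₀ hb hτ₁
  have hΓ'0 : ∀ k l, 0 < Γ' k l := fun k l => (hΓ0 k l).trans_lt (hΓΓ' k l)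
  choose D hD hDM using fun k l => (hg k l).exists_bound ((hΓ k l) ▸ hΓΓ' k l)
  have hD' : 0 ≤ ∏ k, ∏ l, D k l :=
    Finset.prod_nonneg fun k _ => Finset.prod_nonneg fun l _ => hD k l
  have hgrid : ∀ n : ℕ, ((Grid M n).ncard : ℝ) ≤
      ((n : ℝ) + 1) ^ (t + 1 + (u + 1) + t * u) * ((∏ k, ∏ l, D k l) * τ₁ ^ n) := fun n =>
    ncard_grid_le M n (by positivity) fun col row a =>
      ncard_griddedPerms_le hτ10.le hΓ'0 hv hw hΓv hΓw hD hDM col row a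
  generalize t + 1 + (u + 1) + t * u = e at hgrid
  generalize ∏ k, ∏ l, D k l = D₀ at *
  have hlim : Tendsto (fun n : ℕ => 2 ^ e * D₀ * ((n : ℝ) ^ e * (τ₁ / τ₂) ^ n)) atTop (𝓝 0) := by
    have h1 : |τ₁ / τ₂| < 1 := by
      rw [abs_of_pos (by positivity), div_lt_one hτ20]
      exact hτ₁'
    simpa using (tendsto_pow_const_mul_const_pow_of_abs_lt_one e h1).const_mul (2 ^ e * D₀)
  filter_upwards [hlim.eventually_le_const one_pos, eventually_ge_atTop 1] with n hn hn1
  refine lt_of_le_of_lt ?_ hτ₂'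
  rw [one_div, Real.rpow_inv_le_iff_of_pos (by positivity) (by positivity)
    (by exact_mod_cast hn1), Real.rpow_natCast]
  refine (hgrid n).trans ?_
  have hn1' : (1 : ℝ) ≤ n := by exact_mod_cast hn1
  calc ((n : ℝ) + 1) ^ e * (D₀ * τ₁ ^ n) ≤ (2 * n) ^ e * (D₀ * τ₁ ^ n) := by
        gcongr
        linarith
    _ = 2 ^ e * D₀ * ((n : ℝ) ^ e * (τ₁ / τ₂) ^ n) * τ₂ ^ n := by
        rw [div_pow, mul_pow]
        field_simp
    _ ≤ 1 * τ₂ ^ n := by gcongr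
    _ = _ := one_mul _

/-! ### Asymptotics for the lower bound -/

theorem tendsto_log_factorial_div_sub_log :
    Tendsto (fun m : ℕ => Real.log m.factorial / m - Real.log m) atTop (𝓝 (-1)) := by
  have h1 : Tendsto (fun m : ℕ => Real.log (Stirling.stirlingSeq m) / m) atTop (𝓝 0) :=
    (Stirling.tendsto_stirlingSeq_sqrt_pi.log (by positivity)).div_atTop
      tendsto_natCast_atTop_atTop
  have h2 : Tendsto (fun m : ℕ => Real.log (2 * m) / (2 * m)) atTop (𝓝 0) :=
    (Real.isLittleO_log_id_atTop.tendsto_div_nhds_zero).comp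
      (tendsto_natCast_atTop_atTop.const_mul_atTop two_pos)
  have h3 := (h1.add h2).add_const (-1)
  rw [add_zero, zero_add] at h3
  refine h3.congr' ?_
  filter_upwards [eventually_gt_atTop 0] with m hm
  have hm' : (0 : ℝ) < m := by exact_mod_cast hm
  rw [Stirling.log_stirlingSeq_formula, Real.log_div hm'.ne' (Real.exp_ne_zero _), Real.log_exp]
  field_simp
  ring

/-- Subtracting `a n * log n` gives a finite limit; these terms cancel later between numerator and
denominator. For `p = 0` the limit value relies on `Real.log 0 = 0`. -/
theorem tendsto_log_factorial {a : ℕ → ℕ} {p : ℝ} (hp : 0 ≤ p)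
    (ha : Tendsto (fun n => (a n : ℝ) / n) atTop (𝓝 p)) (h0 : p = 0 → ∀ n, a n = 0) :
    Tendsto (fun n : ℕ => (Real.log (a n).factorial - a n * Real.log n) / n) atTop
      (𝓝 (p * Real.log p - p)) := by
  rcases hp.eq_or_lt with rfl | hp
  · simp [h0 rfl]
  have hainf : Tendsto a atTop atTop := by
    have := ha.pos_mul_atTop hp tendsto_natCast_atTop_atTop
    refine tendsto_natCast_atTop_iff (R := ℝ).1 (this.congr' ?_)
    filter_upwards [eventually_gt_atTop 0] with n hn
    field_simp
  have h1 := ha.mul ((tendsto_log_factorial_div_sub_log.comp hainf).add (ha.log hp.ne'))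
  rw [show p * Real.log p - p = p * (-1 + Real.log p) by ring]
  refine h1.congr' ?_
  filter_upwards [eventually_gt_atTop 0, hainf.eventually_gt_atTop 0] with n hn han
  have hn' : (0 : ℝ) < n := by exact_mod_cast hn
  have han' : (0 : ℝ) < a n := by exact_mod_cast han
  simp only [Function.comp_apply]
  rw [Real.log_div han'.ne' hn'.ne']
  field_simp
  ring

/-- Round down everywhere and put the deficit into one coordinate `c₀` of positive weight.
Coordinates of weight zero stay exactly zero, since the class of such a cell may have no members at
all. -/
theorem exists_approximation {K : Type*} [Fintype K] [DecidableEq K] {p : K → ℝ}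
    (hp : ∀ c, 0 ≤ p c) (hsum : ∑ c, p c = 1) :
    ∃ a : ℕ → K → ℕ, (∀ n, ∑ c, a n c = n) ∧ (∀ c, p c = 0 → ∀ n, a n c = 0) ∧
      ∀ c, Tendsto (fun n => (a n c : ℝ) / n) atTop (𝓝 (p c)) := by
  obtain ⟨c₀, -, hc₀⟩ : ∃ c ∈ Finset.univ, p c ≠ 0 :=
    Finset.exists_ne_zero_of_sum_ne_zero (by rw [hsum]; exact one_ne_zero)
  have hfl : ∀ c, Tendsto (fun n : ℕ => (⌊p c * n⌋₊ : ℝ) / n) atTop (𝓝 (p c)) := fun c =>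
    (tendsto_nat_floor_mul_div_atTop (hp c)).comp tendsto_natCast_atTop_atTop
  have hle : ∀ n : ℕ, ∑ c ∈ Finset.univ.erase c₀, ⌊p c * n⌋₊ ≤ n := by
    intro n
    have h1 : ∑ c ∈ Finset.univ.erase c₀, (⌊p c * n⌋₊ : ℝ) ≤ ∑ c, p c * n :=
      (Finset.sum_le_sum fun c _ => Nat.floor_le (mul_nonneg (hp c) n.cast_nonneg)).trans
        (Finset.sum_le_sum_of_subset_of_nonneg (Finset.erase_subset _ _)
          fun c _ _ => mul_nonneg (hp c) n.cast_nonneg)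
    rw [← Finset.sum_mul, hsum, one_mul] at h1
    exact_mod_cast h1
  refine ⟨fun n c => if c = c₀ then n - ∑ c ∈ Finset.univ.erase c₀, ⌊p c * n⌋₊ else ⌊p c * n⌋₊,
    fun n => ?_, fun c hc n => ?_, fun c => ?_⟩
  · beta_reduce
    rw [← Finset.add_sum_erase _ _ (Finset.mem_univ c₀), if_pos rfl,
      Finset.sum_congr rfl fun c hc => if_neg (Finset.ne_of_mem_erase hc)]
    exact Nat.sub_add_cancel (hle n)
  · have hne : c ≠ c₀ := by
      rintro rfl
      exact hc₀ hc
    simp [hne, hc]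
  · by_cases hc : c = c₀
    · subst hc
      simp only [if_true]
      have h1 := (tendsto_const_nhds (x := (1 : ℝ))).sub
        (tendsto_finsetSum (Finset.univ.erase c) fun c _ => hfl c)
      rw [← hsum, ← Finset.add_sum_erase _ _ (Finset.mem_univ c), add_sub_cancel_right] at h1
      refine h1.congr' ?_
      filter_upwards [eventually_gt_atTop 0] with n hn
      have hn' : (0 : ℝ) < n := by exact_mod_cast hn
      rw [Nat.cast_sub (hle n), Finset.add_sum_erase _ _ (Finset.mem_univ c), hsum, sub_div,
        div_self hn'.ne', Nat.cast_sum, Finset.sum_div]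
    · simpa [hc] using hfl c

theorem tendsto_log_cellMembers {C : PermSet} {g p : ℝ} (h : HasProperGrowthRate C g)
    (hp : 0 ≤ p) (hg : 0 < p → 0 < g) {a : ℕ → ℕ}
    (ha : Tendsto (fun n => (a n : ℝ) / n) atTop (𝓝 p)) (h0 : p = 0 → ∀ n, a n = 0) :
    (∀ᶠ n in atTop, 0 < (cellMembers C (a n)).ncard) ∧
    Tendsto (fun n : ℕ => Real.log (cellMembers C (a n)).ncard / n) atTop
      (𝓝 (p * Real.log g)) := by
  rcases hp.eq_or_lt with rfl | hp
  -- The cell stays empty and has exactly one filling, even for the empty class.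
  · obtain rfl : a = fun _ => 0 := funext (h0 rfl)
    have h1 : cellMembers C 0 = Set.univ := by simp [cellMembers]
    simp [h1, Set.ncard_univ]
  have hainf : Tendsto a atTop atTop := by
    have := ha.pos_mul_atTop hp tendsto_natCast_atTop_atTop
    refine tendsto_natCast_atTop_iff (R := ℝ).1 (this.congr' ?_)
    filter_upwards [eventually_gt_atTop 0] with n hn
    field_simp
  have hC : ∀ m, 0 < m → cellMembers C m = C m := fun m hm => by
    ext σ
    simp [cellMembers, hm.ne']
  have hg := hg hp
  have h1 := h.comp hainf
  have hpos : ∀ᶠ n in atTop, 0 < (cellMembers C (a n)).ncard := by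
    filter_upwards [h1.eventually_const_lt hg, hainf.eventually_gt_atTop 0] with n hn han
    rw [hC _ han]
    rw [Nat.pos_iff_ne_zero]
    intro hz
    have han' : (a n : ℝ) ≠ 0 := by exact_mod_cast han.ne'
    simp [hz, Real.zero_rpow (inv_ne_zero han')] at hn
  refine ⟨hpos, (ha.mul (h1.log hg.ne')).congr' ?_⟩
  filter_upwards [hpos, eventually_gt_atTop 0, hainf.eventually_gt_atTop 0] with n hn hn0 han
  have han' : (a n : ℝ) ≠ 0 := by exact_mod_cast han.ne'
  rw [hC _ han] at hn ⊢
  simp only [Function.comp_apply]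
  rw [Real.log_rpow (by exact_mod_cast hn)]
  field_simp

/-- A single pair of divisions, with interval lengths the row and column sums of `a`, already yields
this many permutations. -/
theorem le_ncard_grid {n : ℕ} (a : Fin t → Fin u → ℕ) (ha : ∑ k, ∑ l, a k l = n) :
    (∏ k, ((∑ l, a k l).factorial : ℝ)) * (∏ l, ((∑ k, a k l).factorial : ℝ)) /
      (∏ k, ∏ l, ((a k l).factorial : ℝ)) ^ 2 * ∏ k, ∏ l, ((cellMembers (M k l) (a k l)).ncard : ℝ)
      ≤ (Grid M n).ncard := by
  obtain ⟨col, row, hcol, hrow, hsub⟩ := exists_griddedPerms_subset_grid M a ha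
  have h1 : ((griddedPerms M col row a).ncard : ℝ) ≤ (Grid M n).ncard := by
    exact_mod_cast Set.ncard_le_ncard hsub (Set.toFinite _)
  refine le_trans ?_ h1
  rw [ncard_griddedPerms]
  push_cast
  refine mul_le_mul_of_nonneg_right ?_
    (Finset.prod_nonneg fun k _ => Finset.prod_nonneg fun l _ => by positivity)
  have hF : 0 < ∏ k, ∏ l, ((a k l).factorial : ℝ) :=
    Finset.prod_pos fun k _ => Finset.prod_pos fun l _ => by positivity
  have e1 : ∏ k, ((∑ l, a k l).factorial : ℝ) ≤
      (refinements col a).card * ∏ k, ∏ l, ((a k l).factorial : ℝ) := by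
    exact_mod_cast prod_factorial_le hcol
  have e2 : ∏ l, ((∑ k, a k l).factorial : ℝ) ≤
      (refinements row fun l k => a k l).card * ∏ k, ∏ l, ((a k l).factorial : ℝ) := by
    rw [Finset.prod_comm]
    exact_mod_cast prod_factorial_le hrow
  rw [div_le_iff₀ (by positivity)]
  refine (mul_le_mul e1 e2 (Finset.prod_nonneg fun l _ => by positivity)
    (by positivity)).trans_eq ?_
  ring

end GridClass

/-! ### The lower bound and the theorem -/

namespace GridClass

open Matrix Filter Topology

variable {t u : ℕ} {M : Matrix (Fin t) (Fin u) PermSet}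

theorem eventually_lt_rpow_grid {g Γ : Matrix (Fin t) (Fin u) ℝ}
    (hg : ∀ k l, HasProperGrowthRate (M k l) (g k l)) (hΓ : ∀ k l, Γ k l = √(g k l)) {ρ τ : ℝ}
    {v : Fin u → ℝ} (hρ₀ : 0 ≤ ρ) (hv : ∀ l, 0 ≤ v l) (hv1 : v ⬝ᵥ v = 1)
    (hρ : (Γᵀ * Γ) *ᵥ v = ρ • v) (hτ : τ < ρ) :
    ∀ᶠ n : ℕ in atTop, τ < ((Grid M n).ncard : ℝ) ^ (1 / (n : ℝ)) := by
  -- For `ρ = 0` the bound `τ` is negative and nothing is to be shown.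
  rcases hρ₀.eq_or_lt with rfl | hρ0
  · exact Eventually.of_forall fun n => hτ.trans_le (by positivity)
  have hΓ0 : ∀ k l, 0 ≤ Γ k l := fun k l => hΓ k l ▸ Real.sqrt_nonneg _
  have hs : 0 < √ρ := Real.sqrt_pos.2 hρ0
  have hss : √ρ * √ρ = ρ := Real.mul_self_sqrt hρ0.le
  have hlogs : Real.log ρ = 2 * Real.log √ρ := by
    rw [Real.log_sqrt hρ0.le]
    ring
  set s := √ρ
  let w : Fin t → ℝ := fun k => (Γ *ᵥ v) k / s
  have hw : ∀ k, 0 ≤ w k := fun k =>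
    div_nonneg (Finset.sum_nonneg (s := Finset.univ) (f := fun l => Γ k l * v l)
      fun l _ => mul_nonneg (hΓ0 k l) (hv l)) hs.le
  have hΓv : ∀ k, ∑ l, Γ k l * v l = s * w k := fun k => by
    simp only [w]
    rw [mul_div_cancel₀ _ hs.ne']
    rfl
  have hΓw : ∀ l, ∑ k, Γ k l * w k = s * v l := fun l => by
    have h1 : ∑ k, Γ k l * w k = ((Γᵀ * Γ) *ᵥ v) l / s := by
      rw [← mulVec_mulVec]
      simp only [w, mulVec, dotProduct, transpose_apply, Finset.sum_div, mul_div_assoc]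
    rw [h1, hρ, Pi.smul_apply, smul_eq_mul, ← hss]
    field_simp
  -- A probability distribution on the cells whose marginals are `w k ^ 2` and `v l ^ 2`, by the
  -- singular vector equations `hΓv` and `hΓw`.
  let p : Fin t → Fin u → ℝ := fun k l => w k * Γ k l * v l / s
  have hp : ∀ k l, 0 ≤ p k l := fun k l =>
    div_nonneg (mul_nonneg (mul_nonneg (hw k) (hΓ0 k l)) (hv l)) hs.le
  have hprow : ∀ k, ∑ l, p k l = w k ^ 2 := fun k => by
    have : ∑ l, p k l = w k / s * ∑ l, Γ k l * v l := by
      rw [Finset.mul_sum]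
      exact Finset.sum_congr rfl fun l _ => by simp only [p]; ring
    rw [this, hΓv]
    field_simp
  have hpcol : ∀ l, ∑ k, p k l = v l ^ 2 := fun l => by
    have : ∑ k, p k l = v l / s * ∑ k, Γ k l * w k := by
      rw [Finset.mul_sum]
      exact Finset.sum_congr rfl fun k _ => by simp only [p]; ring
    rw [this, hΓw]
    field_simp
  have hpsum : ∑ k, ∑ l, p k l = 1 := by
    rw [Finset.sum_comm, Finset.sum_congr rfl fun l _ => hpcol l, ← hv1]
    exact Finset.sum_congr rfl fun l _ => sq _
  obtain ⟨a', ha'sum, ha'0, ha'⟩ := exists_approximation (p := fun c : Fin t × Fin u => p c.1 c.2)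
    (fun c => hp _ _) (by rw [Fintype.sum_prod_type]; exact hpsum)
  let a : ℕ → Fin t → Fin u → ℕ := fun n k l => a' n (k, l)
  have hasum : ∀ n, ∑ k, ∑ l, a n k l = n := fun n => by
    rw [← Fintype.sum_prod_type' (fun k l => a n k l)]
    exact ha'sum n
  have ha0 : ∀ k l, p k l = 0 → ∀ n, a n k l = 0 := fun k l h n => ha'0 (k, l) h n
  have ha : ∀ k l, Tendsto (fun n => (a n k l : ℝ) / n) atTop (𝓝 (p k l)) := fun k l => ha' (k, l)
  have hacol : ∀ k, Tendsto (fun n => ((∑ l, a n k l : ℕ) : ℝ) / n) atTop (𝓝 (∑ l, p k l)) := by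
    intro k
    simp only [Nat.cast_sum, Finset.sum_div]
    exact tendsto_finsetSum _ fun l _ => ha k l
  have harow : ∀ l, Tendsto (fun n => ((∑ k, a n k l : ℕ) : ℝ) / n) atTop (𝓝 (∑ k, p k l)) := by
    intro l
    simp only [Nat.cast_sum, Finset.sum_div]
    exact tendsto_finsetSum _ fun k _ => ha k l
  have hcell := fun k l => tendsto_log_cellMembers (hg k l) (hp k l) (fun hpos => by
      rcases (hΓ0 k l).eq_or_lt with h0 | h0
      · simp [p, ← h0] at hpos
      · exact Real.sqrt_pos.1 (hΓ k l ▸ h0)) (ha k l) (ha0 k l)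
  let b : ℕ → ℝ := fun n =>
    (∏ k, ((∑ l, a n k l).factorial : ℝ)) * (∏ l, ((∑ k, a n k l).factorial : ℝ)) /
      (∏ k, ∏ l, ((a n k l).factorial : ℝ)) ^ 2 *
      ∏ k, ∏ l, ((cellMembers (M k l) (a n k l)).ncard : ℝ)
  have hcellpos : ∀ᶠ n in atTop, ∀ k l, 0 < (cellMembers (M k l) (a n k l)).ncard :=
    eventually_all.2 fun k => eventually_all.2 fun l => (hcell k l).1
  have hbpos : ∀ᶠ n in atTop, 0 < b n := by
    filter_upwards [hcellpos] with n hn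
    have h1 : 0 < ∏ k, ∏ l, ((cellMembers (M k l) (a n k l)).ncard : ℝ) :=
      Finset.prod_pos fun k _ => Finset.prod_pos fun l _ => by exact_mod_cast hn k l
    have h2 : 0 < ∏ k, ∏ l, ((a n k l).factorial : ℝ) :=
      Finset.prod_pos fun k _ => Finset.prod_pos fun l _ => by positivity
    positivity
  have hlim : Tendsto (fun n : ℕ => Real.log (b n) / n) atTop (𝓝 (Real.log ρ)) := by
    have h1 := tendsto_finsetSum Finset.univ fun k _ => tendsto_log_factorial
      (Finset.sum_nonneg fun l _ => hp k l) (hacol k) fun h n =>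
        Finset.sum_eq_zero fun l hl => ha0 k l
          ((Finset.sum_eq_zero_iff_of_nonneg fun l _ => hp k l).1 h l hl) n
    have h2 := tendsto_finsetSum Finset.univ fun l _ => tendsto_log_factorial
      (Finset.sum_nonneg fun k _ => hp k l) (harow l) fun h n =>
        Finset.sum_eq_zero fun k hk => ha0 k l
          ((Finset.sum_eq_zero_iff_of_nonneg fun k _ => hp k l).1 h k hk) n
    have h3 := tendsto_finsetSum Finset.univ fun k _ => tendsto_finsetSum Finset.univ fun l _ =>
      tendsto_log_factorial (hp k l) (ha k l) (ha0 k l)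
    have h4 := tendsto_finsetSum Finset.univ fun k _ => tendsto_finsetSum Finset.univ fun l _ =>
      (hcell k l).2
    have h5 := ((h1.add h2).sub (h3.const_mul 2)).add h4
    -- Summed over the cells, the linear terms cancel. As `p k l = w k * Γ k l * v l / s` and `g k l
    -- = Γ k l ^ 2`, the logarithms in each cell combine to `p k l * log (s ^ 2)`, and `s ^ 2 = ρ`.
    have hval : ∑ k, ((∑ l, p k l) * Real.log (∑ l, p k l) - ∑ l, p k l) +
        ∑ l, ((∑ k, p k l) * Real.log (∑ k, p k l) - ∑ k, p k l) -
        2 * ∑ k, ∑ l, (p k l * Real.log (p k l) - p k l) +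
        ∑ k, ∑ l, p k l * Real.log (g k l) = Real.log ρ := by
      have e1 : ∑ l, ((∑ k, p k l) * Real.log (∑ k, p k l) - ∑ k, p k l) =
          ∑ k, ∑ l, (p k l * Real.log (v l ^ 2) - p k l) := by
        rw [Finset.sum_comm]
        refine Finset.sum_congr rfl fun l _ => ?_
        rw [Finset.sum_sub_distrib, ← Finset.sum_mul, hpcol]
      have e2 : ∑ k, ((∑ l, p k l) * Real.log (∑ l, p k l) - ∑ l, p k l) =
          ∑ k, ∑ l, (p k l * Real.log (w k ^ 2) - p k l) := by
        refine Finset.sum_congr rfl fun k _ => ?_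
        rw [Finset.sum_sub_distrib, ← Finset.sum_mul, hprow]
      rw [e1, e2, Finset.mul_sum, ← Finset.sum_add_distrib, ← Finset.sum_sub_distrib,
        ← Finset.sum_add_distrib, ← one_mul (Real.log ρ), ← hpsum, Finset.sum_mul]
      refine Finset.sum_congr rfl fun k _ => ?_
      rw [Finset.mul_sum, ← Finset.sum_add_distrib, ← Finset.sum_sub_distrib,
        ← Finset.sum_add_distrib, Finset.sum_mul]
      refine Finset.sum_congr rfl fun l _ => ?_
      by_cases hpkl : p k l = 0
      · simp [hpkl]
      · have hw0 : w k ≠ 0 := fun h => hpkl (by simp [p, h])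
        have hv0 : v l ≠ 0 := fun h => hpkl (by simp [p, h])
        have hΓ' : Γ k l ≠ 0 := fun h => hpkl (by simp [p, h])
        have hlogp : Real.log (p k l) =
            Real.log (w k) + Real.log (Γ k l) + Real.log (v l) - Real.log s := by
          simp only [p]
          rw [Real.log_div (by positivity) hs.ne', Real.log_mul (by positivity) hv0,
            Real.log_mul hw0 hΓ']
        have hlogΓ : Real.log (g k l) = 2 * Real.log (Γ k l) := by
          rw [hΓ k l, Real.log_sqrt (hg k l).nonneg]
          ring
        rw [hlogp, hlogΓ, hlogs, Real.log_pow, Real.log_pow]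
        push_cast
        ring
    rw [hval] at h5
    refine h5.congr' ?_
    filter_upwards [hcellpos, eventually_gt_atTop 0] with n hn hn0
    have hF : ∀ m : ℕ, (m.factorial : ℝ) ≠ 0 := fun m => by positivity
    have hC : ∀ k l, ((cellMembers (M k l) (a n k l)).ncard : ℝ) ≠ 0 := fun k l => by
      exact_mod_cast (hn k l).ne'
    have hFF : ∏ k, ∏ l, ((a n k l).factorial : ℝ) ≠ 0 :=
      Finset.prod_ne_zero_iff.2 fun k _ => Finset.prod_ne_zero_iff.2 fun l _ => hF _
    have hCC : ∏ k, ∏ l, ((cellMembers (M k l) (a n k l)).ncard : ℝ) ≠ 0 :=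
      Finset.prod_ne_zero_iff.2 fun k _ => Finset.prod_ne_zero_iff.2 fun l _ => hC k l
    have hF1 : ∏ k, ((∑ l, a n k l).factorial : ℝ) ≠ 0 := Finset.prod_ne_zero_iff.2 fun k _ => hF _
    have hF2 : ∏ l, ((∑ k, a n k l).factorial : ℝ) ≠ 0 := Finset.prod_ne_zero_iff.2 fun k _ => hF _
    have hlog : Real.log (b n) = ∑ k, Real.log (∑ l, a n k l).factorial +
        ∑ l, Real.log (∑ k, a n k l).factorial - 2 * ∑ k, ∑ l, Real.log (a n k l).factorial +
        ∑ k, ∑ l, Real.log (cellMembers (M k l) (a n k l)).ncard := by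
      simp only [b]
      rw [Real.log_mul (div_ne_zero (mul_ne_zero hF1 hF2) (pow_ne_zero _ hFF)) hCC,
        Real.log_div (mul_ne_zero hF1 hF2) (pow_ne_zero _ hFF), Real.log_mul hF1 hF2, Real.log_pow,
        Real.log_prod fun k _ => hF _, Real.log_prod fun k _ => hF _,
        Real.log_prod fun k _ => Finset.prod_ne_zero_iff.2 fun l _ => hF _,
        Real.log_prod fun k _ => Finset.prod_ne_zero_iff.2 fun l _ => hC k l]
      simp only [Real.log_prod fun l _ => hF _, Real.log_prod fun l _ => hC _ l]
      push_cast
      rfl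
    have hs1 : ∑ k, ((∑ l, a n k l : ℕ) : ℝ) = n := by exact_mod_cast hasum n
    have hs2 : ∑ l, ((∑ k, a n k l : ℕ) : ℝ) = n := by
      rw [← Nat.cast_sum, Finset.sum_comm, hasum]
    have hs3 : ∑ k, ∑ l, (a n k l : ℝ) = n := by exact_mod_cast hasum n
    -- Columns, rows and cells each have total size `n`, so the `n * log n` corrections cancel as `1
    -- + 1 - 2`.
    rw [hlog]
    simp only [← Finset.sum_div, Finset.sum_sub_distrib, ← Finset.sum_mul, hs1, hs2, hs3]
    ring
  have hexp : Tendsto (fun n : ℕ => Real.exp (Real.log (b n) / n)) atTop (𝓝 ρ) := by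
    have := hlim.rexp
    rwa [Real.exp_log hρ0] at this
  filter_upwards [hexp.eventually_const_lt hτ, hbpos] with n hn hbn
  refine hn.trans_le ?_
  rw [div_eq_mul_one_div, ← Real.rpow_def_of_pos hbn]
  exact Real.rpow_le_rpow hbn.le (le_ncard_grid (a n) (hasum n)) (by positivity)

end GridClass

theorem theorem1 (t u : ℕ) (ht : 0 < t) (hu : 0 < u)
    (M : Matrix (Fin t) (Fin u) GridClass.PermSet)
    (hM : ∀ k l, GridClass.IsPermClass (M k l))
    (g : Matrix (Fin t) (Fin u) ℝ)
    (hg : ∀ k l, GridClass.HasProperGrowthRate (M k l) (g k l))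
    (Γ : Matrix (Fin t) (Fin u) ℝ)
    (hΓ : ∀ k l, Γ k l = Real.sqrt (g k l)) :
    ∃ ρ : ℝ, GridClass.HasProperGrowthRate (GridClass.Grid M) ρ ∧
      IsGreatest {μ : ℝ | Module.End.HasEigenvalue (Matrix.toLin' (Γ.transpose * Γ)) μ} ρ ∧
      IsGreatest {μ : ℝ | Module.End.HasEigenvalue (Matrix.toLin' (Γ * Γ.transpose)) μ} ρ := by
  have : Nonempty (Fin t) := ⟨⟨0, ht⟩⟩
  have : Nonempty (Fin u) := ⟨⟨0, hu⟩⟩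
  have hΓ0 : ∀ k l, 0 ≤ Γ k l := fun k l => hΓ k l ▸ Real.sqrt_nonneg _
  obtain ⟨ρ, v, hρ₀, hv, hv1, hρ, hb⟩ := GridClass.exists_nonneg_eigenvector hΓ0
  exact ⟨ρ, tendsto_order.2
    ⟨fun τ hτ => GridClass.eventually_lt_rpow_grid hg hΓ hρ₀ hv hv1 hρ hτ,
      fun τ hτ => GridClass.eventually_rpow_grid_lt hg hΓ hρ₀ hb hτ⟩,
    GridClass.isGreatest_eigenvalues_gram hv1 hρ hb,
    GridClass.isGreatest_eigenvalues_gram_transpose hρ₀ hv1 hρ hb⟩
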